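/- Let $\Gamma$ be a coalgebra over a field $k$, with comultiplication $c \mapsto \sum c_1 \otimes c_2$, and let $D = \operatorname{Hom}_k(-,k)$. A right (left) $\Gamma$-comodule $M$ is called quasifinite if $\operatorname{Hom}_{\Gamma}(F,M)$ is finite-dimensional for every finite-dimensional right (left) comodule $F$. For a quasifinite right comodule $M$ let $$M^{*} = h_{-\Gamma}(M,\Gamma) = \varinjlim_{N} D\operatorname{Hom}_{-\Gamma}(N,M),$$ where $N$ runs through the finite-dimensional right subcomodules of $\Gamma$. With the canonical map $\theta_M\colon \Gamma \to M^{*}\otimes M$ (through which every comodule map $\Gamma \to W\otimes M$, $W$ a vector space, factors as $(u\otimes 1)\theta_M$ for a unique linear map $u\colon M^{*}\to W$), the space $M^{*}$ is a left $\Gamma$-comodule, whose coaction $\lambda$ is determined by $(\lambda\otimes 1)\theta_M(c) = \sum c_1\otimes\theta_M(c_2)$ for $c\in\Gamma$. This defines a contravariant functor $*$ from quasifinite right comodules to left comodules; the functor $*$ from quasifinite left comodules to right comodules is defined symmetrically. (1) The functors $*$ map quasifinite injective comodules to quasifinite injective comodules, and restrict to a duality (mutually quasi-inverse contravariant equivalences)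 between the category of quasifinite injective right $\Gamma$-comodules and the category of quasifinite injective left $\Gamma$-comodules; in particular $I^{**}\cong I$ naturally in $I$, on both sides. (2) For every idempotent $e = e^2$ of the dual algebra $R = D\Gamma$ (with the convolution product), the right comodule $\Gamma e = \{\sum e(c_1)c_2 : c\in\Gamma\}$ is quasifinite and injective, and $(\Gamma e)^{*} \cong e\Gamma = \{\sum c_1 e(c_2) : c \in\Gamma\}$ as left $\Gamma$-comodules. -/

import Mathlib

open CategoryTheory TensorProduct Coalgebra

universe u

noncomputable section

namespace Comodule

section LinearAlgebra

variable {k : Type u} [Field k]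

/-- The map `V ⊗ M → M`, `v ⊗ m ↦ φ v • m`. -/
def slice {V : Type u} [AddCommGroup V] [Module k V] (M : Type u) [AddCommGroup M] [Module k M]
    (φ : V →ₗ[k] k) : V ⊗[k] M →ₗ[k] M :=
  (TensorProduct.lid k M).toLinearMap ∘ₗ φ.rTensor M

variable {V W M N G : Type u} [AddCommGroup V] [Module k V] [AddCommGroup W] [Module k W]
  [AddCommGroup M] [Module k M] [AddCommGroup N] [Module k N] [AddCommGroup G] [Module k G]

@[simp] theorem slice_tmul (φ : V →ₗ[k] k) (v : V) (m : M) : slice M φ (v ⊗ₜ m) = φ v • m := by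
  simp [slice]

theorem slice_rTensor (φ : W →ₗ[k] k) (u : V →ₗ[k] W) (t : V ⊗[k] M) :
    slice M φ (u.rTensor M t) = slice M (φ ∘ₗ u) t := by
  induction t with
  | zero => simp
  | tmul v m => simp
  | add x y hx hy => simp only [map_add, hx, hy]

theorem slice_lTensor (φ : V →ₗ[k] k) (f : M →ₗ[k] N) (t : V ⊗[k] M) :
    slice N φ (f.lTensor V t) = f (slice M φ t) := by
  induction t with
  | zero => simp
  | tmul v m => simp
  | add x y hx hy => simp only [map_add, hx, hy]

theorem slice_assoc_symm (φ : V →ₗ[k] k) (t : V ⊗[k] (M ⊗[k] N)) :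
    (slice M φ).rTensor N ((TensorProduct.assoc k V M N).symm t) = slice (M ⊗[k] N) φ t := by
  induction t with
  | zero => simp
  | add x y hx hy => simp only [map_add, hx, hy]
  | tmul v s =>
    induction s with
    | zero => simp
    | tmul m n => simp [TensorProduct.smul_tmul']
    | add x y hx hy => simp only [map_add, hx, hy, tmul_add]

theorem slice_rid (φ : V →ₗ[k] k) (L : M →ₗ[k] k) (t : V ⊗[k] M) :
    φ (TensorProduct.rid k V (L.lTensor V t)) = L (slice M φ t) := by
  induction t with
  | zero => simp
  | tmul v m => simp [mul_comm]
  | add x y hx hy => simp only [map_add, hx, hy]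

/-- Elements of `V ⊗ M` are separated by the functionals on `V`. -/
theorem slice_ext {s t : V ⊗[k] M} (h : ∀ φ : V →ₗ[k] k, slice M φ s = slice M φ t) : s = t := by
  classical
  let b := Module.Basis.ofVectorSpace k V
  apply (TensorProduct.equivFinsuppOfBasisLeft (N := M) b).injective
  ext i
  rw [TensorProduct.equivFinsuppOfBasisLeft_apply, TensorProduct.equivFinsuppOfBasisLeft_apply]
  exact h (b.coord i)

/-- A tensor in `N ⊗ G` comes from the span of its left components. -/
theorem mem_range_rTensor_of_forall (t : N ⊗[k] G) (p : Submodule k N)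
    (h : ∀ φ : G →ₗ[k] k, TensorProduct.rid k N (φ.lTensor N t) ∈ p) :
    t ∈ LinearMap.range (p.subtype.rTensor G) := by
  classical
  let b := Module.Basis.ofVectorSpace k G
  obtain ⟨c, rfl⟩ := TensorProduct.eq_repr_basis_right b t
  refine Submodule.sum_mem _ fun i hi => ?_
  have hc : c i ∈ p := by
    have := h (b.coord i)
    have e := TensorProduct.equivFinsuppOfBasisRight_apply b (c.sum fun i m => m ⊗ₜ[k] b i) i
    have e2 := TensorProduct.equivFinsuppOfBasisRight_symm_apply b c
    rw [← e2, LinearEquiv.apply_symm_apply] at e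
    rw [e2] at e
    rw [e]
    exact this
  exact ⟨(⟨c i, hc⟩ : p) ⊗ₜ b i, by simp⟩

end LinearAlgebra

section CoalgebraIdentities

variable {k Γ : Type u} [Field k] [AddCommGroup Γ] [Module k Γ] [Coalgebra k Γ]
  {h M h' M' : Type u} [AddCommGroup h] [Module k h] [AddCommGroup M] [Module k M]
  [AddCommGroup h'] [Module k h'] [AddCommGroup M'] [Module k M']

theorem coactAux_colinear (ρ : M →ₗ[k] M ⊗[k] Γ) (θ : Γ →ₗ[k] h ⊗[k] M)
    (hθ : (TensorProduct.assoc k h M Γ).symm.toLinearMap ∘ₗ ρ.lTensor h ∘ₗ θ =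
      θ.rTensor Γ ∘ₗ comul) :
    (TensorProduct.assoc k (Γ ⊗[k] h) M Γ).symm.toLinearMap ∘ₗ ρ.lTensor (Γ ⊗[k] h) ∘ₗ
      (TensorProduct.assoc k Γ h M).symm.toLinearMap ∘ₗ θ.lTensor Γ ∘ₗ comul =
    ((TensorProduct.assoc k Γ h M).symm.toLinearMap ∘ₗ θ.lTensor Γ ∘ₗ comul).rTensor Γ ∘ₗ
      comul := by
  let α : Γ ⊗[k] ((h ⊗[k] M) ⊗[k] Γ) →ₗ[k] ((Γ ⊗[k] h) ⊗[k] M) ⊗[k] Γ :=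
    ((TensorProduct.assoc k Γ h M).symm.toLinearMap).rTensor Γ ∘ₗ
      (TensorProduct.assoc k Γ (h ⊗[k] M) Γ).symm.toLinearMap
  have e1 : (TensorProduct.assoc k (Γ ⊗[k] h) M Γ).symm.toLinearMap ∘ₗ
      ρ.lTensor (Γ ⊗[k] h) ∘ₗ (TensorProduct.assoc k Γ h M).symm.toLinearMap =
      α ∘ₗ ((TensorProduct.assoc k h M Γ).symm.toLinearMap ∘ₗ ρ.lTensor h).lTensor Γ := by
    ext a b m
    simp only [α, AlgebraTensorModule.curry_apply, curry_apply, LinearMap.restrictScalars_apply,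
      LinearMap.comp_apply, LinearEquiv.coe_coe, TensorProduct.assoc_symm_tmul,
      LinearMap.lTensor_tmul]
    induction ρ m with
    | zero => simp
    | add a b ha hb => simp only [map_add, tmul_add, ha, hb]
    | tmul a b => simp
  have e2 : α ∘ₗ (θ.rTensor Γ).lTensor Γ ∘ₗ (TensorProduct.assoc k Γ Γ Γ).toLinearMap =
      ((TensorProduct.assoc k Γ h M).symm.toLinearMap ∘ₗ θ.lTensor Γ).rTensor Γ := by
    ext a b c
    simp [α]
  calc _ = ((TensorProduct.assoc k (Γ ⊗[k] h) M Γ).symm.toLinearMap ∘ₗ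
      ρ.lTensor (Γ ⊗[k] h) ∘ₗ (TensorProduct.assoc k Γ h M).symm.toLinearMap) ∘ₗ
        θ.lTensor Γ ∘ₗ comul := rfl
    _ = α ∘ₗ (((TensorProduct.assoc k h M Γ).symm.toLinearMap ∘ₗ
        ρ.lTensor h).lTensor Γ ∘ₗ θ.lTensor Γ) ∘ₗ comul := by rw [e1]; rfl
    _ = α ∘ₗ (θ.rTensor Γ).lTensor Γ ∘ₗ ((comul (R := k) (A := Γ)).lTensor Γ ∘ₗ comul) := by
      have hθ' : ((TensorProduct.assoc k h M Γ).symm.toLinearMap ∘ₗ ρ.lTensor h) ∘ₗ θ =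
        θ.rTensor Γ ∘ₗ comul := hθ
      rw [← LinearMap.lTensor_comp, hθ', LinearMap.lTensor_comp]; rfl
    _ = (α ∘ₗ (θ.rTensor Γ).lTensor Γ ∘ₗ (TensorProduct.assoc k Γ Γ Γ).toLinearMap) ∘ₗ
          (comul (R := k) (A := Γ)).rTensor Γ ∘ₗ comul := by
      rw [← Coalgebra.coassoc]; rfl
    _ = _ := by
      rw [e2, ← LinearMap.comp_assoc, ← LinearMap.rTensor_comp]; rfl

theorem coassocAux (θ : Γ →ₗ[k] h ⊗[k] M) (u : h →ₗ[k] Γ ⊗[k] h)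
    (hc : u.rTensor M ∘ₗ θ = (TensorProduct.assoc k Γ h M).symm.toLinearMap ∘ₗ
      θ.lTensor Γ ∘ₗ comul) :
    ((TensorProduct.assoc k Γ Γ h).toLinearMap ∘ₗ
      (comul (R := k) (A := Γ)).rTensor h ∘ₗ u).rTensor M ∘ₗ θ =
    (u.lTensor Γ ∘ₗ u).rTensor M ∘ₗ θ := by
  let β : Γ ⊗[k] (Γ ⊗[k] (h ⊗[k] M)) →ₗ[k] (Γ ⊗[k] (Γ ⊗[k] h)) ⊗[k] M :=
    (TensorProduct.assoc k Γ (Γ ⊗[k] h) M).symm.toLinearMap ∘ₗ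
      ((TensorProduct.assoc k Γ h M).symm.toLinearMap).lTensor Γ
  let γ : (Γ ⊗[k] Γ) ⊗[k] (h ⊗[k] M) →ₗ[k] (Γ ⊗[k] (Γ ⊗[k] h)) ⊗[k] M :=
    (TensorProduct.assoc k Γ Γ h).toLinearMap.rTensor M ∘ₗ
      (TensorProduct.assoc k (Γ ⊗[k] Γ) h M).symm.toLinearMap
  have eA : ((TensorProduct.assoc k Γ Γ h).toLinearMap ∘ₗ
      (comul (R := k) (A := Γ)).rTensor h).rTensor M ∘ₗ
        (TensorProduct.assoc k Γ h M).symm.toLinearMap =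
      γ ∘ₗ (comul (R := k) (A := Γ)).rTensor (h ⊗[k] M) := by
    ext a b m
    simp [γ]
  have eB : β ∘ₗ (TensorProduct.assoc k Γ Γ (h ⊗[k] M)).toLinearMap = γ := by
    ext a b c m
    simp [γ, β]
  have eC : (θ.lTensor Γ).lTensor Γ ∘ₗ (TensorProduct.assoc k Γ Γ Γ).toLinearMap =
      (TensorProduct.assoc k Γ Γ (h ⊗[k] M)).toLinearMap ∘ₗ θ.lTensor (Γ ⊗[k] Γ) := by
    ext a b c
    simp
  have e1 : ((TensorProduct.assoc k Γ Γ h).toLinearMap ∘ₗ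
      (comul (R := k) (A := Γ)).rTensor h).rTensor M ∘ₗ
        (TensorProduct.assoc k Γ h M).symm.toLinearMap ∘ₗ θ.lTensor Γ =
      β ∘ₗ (θ.lTensor Γ).lTensor Γ ∘ₗ (TensorProduct.assoc k Γ Γ Γ).toLinearMap ∘ₗ
        (comul (R := k) (A := Γ)).rTensor Γ := by
    rw [← LinearMap.comp_assoc, eA, LinearMap.comp_assoc, LinearMap.rTensor_comp_lTensor,
      ← LinearMap.lTensor_comp_rTensor, ← eB]
    change β ∘ₗ ((TensorProduct.assoc k Γ Γ (h ⊗[k] M)).toLinearMap ∘ₗ θ.lTensor (Γ ⊗[k] Γ)) ∘ₗ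
      (comul (R := k) (A := Γ)).rTensor Γ = _
    rw [← eC]
    rfl
  have e2 : ((u.lTensor Γ).rTensor M) ∘ₗ
        (TensorProduct.assoc k Γ h M).symm.toLinearMap =
      (TensorProduct.assoc k Γ (Γ ⊗[k] h) M).symm.toLinearMap ∘ₗ (u.rTensor M).lTensor Γ := by
    ext a b m
    simp
  calc _ = ((TensorProduct.assoc k Γ Γ h).toLinearMap ∘ₗ
      (comul (R := k) (A := Γ)).rTensor h).rTensor M ∘ₗ (u.rTensor M ∘ₗ θ) := by
        rw [← LinearMap.comp_assoc, LinearMap.rTensor_comp, LinearMap.comp_assoc]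
    _ = (((TensorProduct.assoc k Γ Γ h).toLinearMap ∘ₗ
      (comul (R := k) (A := Γ)).rTensor h).rTensor M ∘ₗ
        (TensorProduct.assoc k Γ h M).symm.toLinearMap ∘ₗ θ.lTensor Γ) ∘ₗ comul := by
        rw [hc]; rfl
    _ = β ∘ₗ (θ.lTensor Γ).lTensor Γ ∘ₗ ((comul (R := k) (A := Γ)).lTensor Γ ∘ₗ comul) := by
        rw [e1, ← Coalgebra.coassoc]; rfl
    _ = (TensorProduct.assoc k Γ (Γ ⊗[k] h) M).symm.toLinearMap ∘ₗ
        ((u.rTensor M).lTensor Γ ∘ₗ θ.lTensor Γ) ∘ₗ comul := by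
        rw [← LinearMap.lTensor_comp, hc]
        simp only [β, LinearMap.lTensor_comp]
        rfl
    _ = ((u.lTensor Γ).rTensor M ∘ₗ
        (TensorProduct.assoc k Γ h M).symm.toLinearMap) ∘ₗ θ.lTensor Γ ∘ₗ comul := by
        rw [e2]; rfl
    _ = (u.lTensor Γ).rTensor M ∘ₗ (u.rTensor M ∘ₗ θ) := by
        rw [hc]; rfl
    _ = _ := by rw [← LinearMap.comp_assoc, LinearMap.rTensor_comp]

theorem counitAux (θ : Γ →ₗ[k] h ⊗[k] M) (u : h →ₗ[k] Γ ⊗[k] h)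
    (hc : u.rTensor M ∘ₗ θ = (TensorProduct.assoc k Γ h M).symm.toLinearMap ∘ₗ
      θ.lTensor Γ ∘ₗ comul) :
    ((counit (R := k) (A := Γ)).rTensor h ∘ₗ u).rTensor M ∘ₗ θ =
      (TensorProduct.mk k k h 1).rTensor M ∘ₗ θ := by
  have e1 : ((counit (R := k) (A := Γ)).rTensor h).rTensor M ∘ₗ
      (TensorProduct.assoc k Γ h M).symm.toLinearMap =
      (TensorProduct.assoc k k h M).symm.toLinearMap ∘ₗ
        (counit (R := k) (A := Γ)).rTensor (h ⊗[k] M) := by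
    ext a b m
    simp
  calc _ = ((counit (R := k) (A := Γ)).rTensor h).rTensor M ∘ₗ (u.rTensor M ∘ₗ θ) := by
        rw [LinearMap.rTensor_comp, LinearMap.comp_assoc]
    _ = (((counit (R := k) (A := Γ)).rTensor h).rTensor M ∘ₗ
      (TensorProduct.assoc k Γ h M).symm.toLinearMap) ∘ₗ θ.lTensor Γ ∘ₗ comul := by
        rw [hc]; rfl
    _ = (TensorProduct.assoc k k h M).symm.toLinearMap ∘ₗ
        ((counit (R := k) (A := Γ)).rTensor (h ⊗[k] M) ∘ₗ θ.lTensor Γ) ∘ₗ comul := by rw [e1]; rfl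
    _ = (TensorProduct.assoc k k h M).symm.toLinearMap ∘ₗ θ.lTensor k ∘ₗ
        ((counit (R := k) (A := Γ)).rTensor Γ ∘ₗ comul) := by
        rw [LinearMap.rTensor_comp_lTensor, ← LinearMap.lTensor_comp_rTensor]; rfl
    _ = _ := by
      rw [Coalgebra.rTensor_counit_comp_comul]
      ext a
      simp only [LinearMap.comp_apply, LinearEquiv.coe_coe, LinearMap.lTensor_tmul, mk_apply]
      induction θ a with
      | zero => simp
      | add x y hx hy => simp only [map_add, tmul_add, hx, hy]
      | tmul x y => simp

theorem mapAux (f : M →ₗ[k] M') (v : h' →ₗ[k] h) (θ : Γ →ₗ[k] h ⊗[k] M)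
    (θ' : Γ →ₗ[k] h' ⊗[k] M') (u : h →ₗ[k] Γ ⊗[k] h) (u' : h' →ₗ[k] Γ ⊗[k] h')
    (hc : u.rTensor M ∘ₗ θ = (TensorProduct.assoc k Γ h M).symm.toLinearMap ∘ₗ
      θ.lTensor Γ ∘ₗ comul)
    (hc' : u'.rTensor M' ∘ₗ θ' = (TensorProduct.assoc k Γ h' M').symm.toLinearMap ∘ₗ
      θ'.lTensor Γ ∘ₗ comul)
    (hf : v.rTensor M' ∘ₗ θ' = f.lTensor h ∘ₗ θ) :
    (u ∘ₗ v).rTensor M' ∘ₗ θ' = (v.lTensor Γ ∘ₗ u').rTensor M' ∘ₗ θ' := by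
  have e1 : (v.lTensor Γ).rTensor M' ∘ₗ (TensorProduct.assoc k Γ h' M').symm.toLinearMap =
      (TensorProduct.assoc k Γ h M').symm.toLinearMap ∘ₗ (v.rTensor M').lTensor Γ := by
    ext a b m
    simp
  have e2 : f.lTensor (Γ ⊗[k] h) ∘ₗ (TensorProduct.assoc k Γ h M).symm.toLinearMap =
      (TensorProduct.assoc k Γ h M').symm.toLinearMap ∘ₗ (f.lTensor h).lTensor Γ := by
    ext a b m
    simp
  calc _ = u.rTensor M' ∘ₗ (v.rTensor M' ∘ₗ θ') := by
        rw [LinearMap.rTensor_comp, LinearMap.comp_assoc]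
    _ = f.lTensor (Γ ⊗[k] h) ∘ₗ (u.rTensor M ∘ₗ θ) := by
        rw [hf, ← LinearMap.comp_assoc, LinearMap.rTensor_comp_lTensor,
          ← LinearMap.lTensor_comp_rTensor, LinearMap.comp_assoc]
    _ = (f.lTensor (Γ ⊗[k] h) ∘ₗ
        (TensorProduct.assoc k Γ h M).symm.toLinearMap) ∘ₗ θ.lTensor Γ ∘ₗ comul := by
        rw [hc]; rfl
    _ = (TensorProduct.assoc k Γ h M').symm.toLinearMap ∘ₗ
        ((f.lTensor h).lTensor Γ ∘ₗ θ.lTensor Γ) ∘ₗ comul := by rw [e2]; rfl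
    _ = (TensorProduct.assoc k Γ h M').symm.toLinearMap ∘ₗ
        ((v.rTensor M').lTensor Γ ∘ₗ θ'.lTensor Γ) ∘ₗ comul := by
        rw [← LinearMap.lTensor_comp, ← hf, LinearMap.lTensor_comp]
    _ = ((v.lTensor Γ).rTensor M' ∘ₗ
      (TensorProduct.assoc k Γ h' M').symm.toLinearMap) ∘ₗ θ'.lTensor Γ ∘ₗ comul := by
        rw [e1]; rfl
    _ = (v.lTensor Γ).rTensor M' ∘ₗ (u'.rTensor M' ∘ₗ θ') := by rw [hc']; rfl
    _ = _ := by rw [LinearMap.rTensor_comp, LinearMap.comp_assoc]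

end CoalgebraIdentities


/-- A right comodule over the `k`-coalgebra `Γ`: a vector space `M` with a coassociative and
counital coaction `M → M ⊗ Γ`. -/
structure RightComod (k Γ : Type u) [Field k] [AddCommGroup Γ] [Module k Γ] [Coalgebra k Γ] where
  /-- the underlying vector space -/
  carrier : Type u
  [addCommGroup : AddCommGroup carrier]
  [module : Module k carrier]
  /-- the coaction -/
  coact : carrier →ₗ[k] carrier ⊗[k] Γ
  coassoc : (TensorProduct.assoc k carrier Γ Γ).toLinearMap ∘ₗ coact.rTensor Γ ∘ₗ coact =
    (comul (R := k) (A := Γ)).lTensor carrier ∘ₗ coact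
  counit_coact : (counit (R := k) (A := Γ)).lTensor carrier ∘ₗ coact =
    (TensorProduct.mk k carrier k).flip 1

/-- A left comodule over the `k`-coalgebra `Γ`: a vector space `M` with a coassociative and
counital coaction `M → Γ ⊗ M`. -/
structure LeftComod (k Γ : Type u) [Field k] [AddCommGroup Γ] [Module k Γ] [Coalgebra k Γ] where
  /-- the underlying vector space -/
  carrier : Type u
  [addCommGroup : AddCommGroup carrier]
  [module : Module k carrier]
  /-- the coaction -/
  coact : carrier →ₗ[k] Γ ⊗[k] carrier
  coassoc : (TensorProduct.assoc k Γ Γ carrier).toLinearMap ∘ₗ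
      (comul (R := k) (A := Γ)).rTensor carrier ∘ₗ coact = coact.lTensor Γ ∘ₗ coact
  counit_coact : (counit (R := k) (A := Γ)).rTensor carrier ∘ₗ coact =
    TensorProduct.mk k k carrier 1

attribute [instance] RightComod.addCommGroup RightComod.module
attribute [instance] LeftComod.addCommGroup LeftComod.module

variable {k Γ : Type u} [Field k] [AddCommGroup Γ] [Module k Γ] [Coalgebra k Γ]

namespace RightComod

/-- `Hom_{-Γ}(M, N)`: the space of right comodule maps `M → N`. -/
def homs (M N : RightComod k Γ) : Submodule k (M.carrier →ₗ[k] N.carrier) where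
  carrier := {f | N.coact ∘ₗ f = f.rTensor Γ ∘ₗ M.coact}
  zero_mem' := by simp
  add_mem' := by
    intro f g hf hg
    change _ = _ at hf hg
    change _ = _
    rw [LinearMap.comp_add, hf, hg, LinearMap.rTensor_add, LinearMap.add_comp]
  smul_mem' := by
    intro c f hf
    change _ = _ at hf
    change _ = _
    rw [LinearMap.comp_smul, hf, LinearMap.rTensor_smul, LinearMap.smul_comp]

theorem mem_homs {M N : RightComod k Γ} {f : M.carrier →ₗ[k] N.carrier} :
    f ∈ homs M N ↔ N.coact ∘ₗ f = f.rTensor Γ ∘ₗ M.coact := Iff.rfl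

theorem homs_apply {M N : RightComod k Γ} (f : homs M N) (x : M.carrier) :
    N.coact (f.1 x) = f.1.rTensor Γ (M.coact x) := LinearMap.congr_fun f.2 x

theorem comp_mem {M N P : RightComod k Γ} (f : homs M N) (g : homs N P) :
    g.1 ∘ₗ f.1 ∈ homs M P := by
  rw [mem_homs, ← LinearMap.comp_assoc, mem_homs.1 g.2, LinearMap.comp_assoc, mem_homs.1 f.2,
    ← LinearMap.comp_assoc, ← LinearMap.rTensor_comp]

/-- The category of right `Γ`-comodules. -/
instance : Category (RightComod k Γ) where
  Hom M N := homs M N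
  id M := ⟨LinearMap.id, by simp [mem_homs]⟩
  comp f g := ⟨g.1 ∘ₗ f.1, comp_mem f g⟩

/-- `M` is quasifinite if `Hom_{-Γ}(F, M)` is finite-dimensional for all finite-dimensional `F`. -/
def IsQuasifinite : ObjectProperty (RightComod k Γ) := fun M =>
  ∀ F : RightComod k Γ, Module.Finite k F.carrier → Module.Finite k (homs F M)

/-- Quasifinite and injective. -/
def IsQuasifiniteInjective : ObjectProperty (RightComod k Γ) := fun M =>
  IsQuasifinite M ∧ Injective M

/-- `Γ` as a right comodule over itself. -/
abbrev regular (k Γ : Type u) [Field k] [AddCommGroup Γ] [Module k Γ] [Coalgebra k Γ] :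
    RightComod k Γ where
  carrier := Γ
  coact := comul
  coassoc := Coalgebra.coassoc
  counit_coact := Coalgebra.lTensor_counit_comp_comul

/-- A subspace `p ⊆ N` is a subcomodule if the coaction maps `p` into `p ⊗ Γ ⊆ N ⊗ Γ`. -/
def IsSubcomodule (N : RightComod k Γ) (p : Submodule k N.carrier) : Prop :=
  ∀ x ∈ p, N.coact x ∈ LinearMap.range (p.subtype.rTensor Γ)

theorem rTensor_subtype_injective {N G : Type u} [AddCommGroup N] [Module k N] [AddCommGroup G]
    [Module k G] (p : Submodule k N) : Function.Injective (p.subtype.rTensor G) :=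
  Module.Flat.rTensor_preserves_injective_linearMap _ p.injective_subtype

/-- The coaction of a subcomodule. -/
def subCoact (N : RightComod k Γ) (p : Submodule k N.carrier) (hp : N.IsSubcomodule p) :
    p →ₗ[k] p ⊗[k] Γ :=
  (LinearEquiv.ofInjective (p.subtype.rTensor Γ) (rTensor_subtype_injective p)).symm.toLinearMap ∘ₗ
    (N.coact ∘ₗ p.subtype).codRestrict _ (fun x => hp x.1 x.2)

theorem subtype_subCoact (N : RightComod k Γ) (p : Submodule k N.carrier)
    (hp : N.IsSubcomodule p) :
    p.subtype.rTensor Γ ∘ₗ N.subCoact p hp = N.coact ∘ₗ p.subtype := by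
  ext x
  have := LinearEquiv.apply_symm_apply
    (LinearEquiv.ofInjective (p.subtype.rTensor Γ) (rTensor_subtype_injective p))
    ((N.coact ∘ₗ p.subtype).codRestrict _ (fun x => hp x.1 x.2) x)
  exact congrArg Subtype.val this

/-- A subcomodule, as a comodule. -/
def sub (N : RightComod k Γ) (p : Submodule k N.carrier) (hp : N.IsSubcomodule p) :
    RightComod k Γ where
  carrier := p
  coact := N.subCoact p hp
  coassoc := by
    have h := N.subtype_subCoact p hp
    have inj : Function.Injective (p.subtype.rTensor (Γ ⊗[k] Γ)) :=
      rTensor_subtype_injective p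
    rw [← LinearMap.cancel_left inj]
    have e1 : p.subtype.rTensor (Γ ⊗[k] Γ) ∘ₗ (TensorProduct.assoc k p Γ Γ).toLinearMap =
        (TensorProduct.assoc k N.carrier Γ Γ).toLinearMap ∘ₗ
          (p.subtype.rTensor Γ).rTensor Γ := by
      ext; rfl
    have e2 : p.subtype.rTensor (Γ ⊗[k] Γ) ∘ₗ (comul (R := k) (A := Γ)).lTensor p =
        (comul (R := k) (A := Γ)).lTensor N.carrier ∘ₗ p.subtype.rTensor Γ := by
      ext; rfl
    have e3 : (p.subtype.rTensor Γ).rTensor Γ ∘ₗ (N.subCoact p hp).rTensor Γ =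
        N.coact.rTensor Γ ∘ₗ p.subtype.rTensor Γ := by
      rw [← LinearMap.rTensor_comp, h, LinearMap.rTensor_comp]
    calc _ = (TensorProduct.assoc k N.carrier Γ Γ).toLinearMap ∘ₗ
          ((p.subtype.rTensor Γ).rTensor Γ ∘ₗ (N.subCoact p hp).rTensor Γ) ∘ₗ N.subCoact p hp := by
          rw [← LinearMap.comp_assoc, e1]; rfl
      _ = (TensorProduct.assoc k N.carrier Γ Γ).toLinearMap ∘ₗ N.coact.rTensor Γ ∘ₗ
          (p.subtype.rTensor Γ ∘ₗ N.subCoact p hp) := by rw [e3]; rfl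
      _ = (comul (R := k) (A := Γ)).lTensor N.carrier ∘ₗ N.coact ∘ₗ p.subtype := by
          rw [h, ← LinearMap.comp_assoc p.subtype, ← LinearMap.comp_assoc, N.coassoc]; rfl
      _ = _ := by rw [← h, ← LinearMap.comp_assoc, ← e2]; rfl
  counit_coact := by
    have h := N.subtype_subCoact p hp
    have inj : Function.Injective (p.subtype.rTensor k) := rTensor_subtype_injective p
    rw [← LinearMap.cancel_left inj]
    have e2 : p.subtype.rTensor k ∘ₗ (counit (R := k) (A := Γ)).lTensor p =
        (counit (R := k) (A := Γ)).lTensor N.carrier ∘ₗ p.subtype.rTensor Γ := by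
      ext; rfl
    rw [← LinearMap.comp_assoc, e2, LinearMap.comp_assoc, h, ← LinearMap.comp_assoc,
      N.counit_coact]
    ext; simp

/-- The finite-dimensional subcomodules of `N`. -/
structure FDSub (N : RightComod k Γ) : Type u where
  /-- the underlying subspace -/
  space : Submodule k N.carrier
  isSubcomodule : N.IsSubcomodule space
  finite : Module.Finite k space

theorem FDSub.space_injective (N : RightComod k Γ) :
    Function.Injective (FDSub.space : N.FDSub → Submodule k N.carrier) := by
  rintro ⟨p, _, _⟩ ⟨q, _, _⟩ h
  cases h
  rfl

/-- Finite-dimensional subcomodules are ordered by inclusion. -/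
instance (N : RightComod k Γ) : PartialOrder N.FDSub :=
  PartialOrder.lift FDSub.space (FDSub.space_injective N)

theorem isSubcomodule_mono {N : RightComod k Γ} {p q : Submodule k N.carrier} (h : p ≤ q) {x}
    (hx : x ∈ LinearMap.range (p.subtype.rTensor Γ)) :
    x ∈ LinearMap.range (q.subtype.rTensor Γ) := by
  obtain ⟨y, rfl⟩ := hx
  refine ⟨(Submodule.inclusion h).rTensor Γ y, ?_⟩
  rw [← LinearMap.comp_apply, ← LinearMap.rTensor_comp]
  rfl

instance (N : RightComod k Γ) : Nonempty N.FDSub :=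
  ⟨⟨⊥, by rintro x hx; rw [(Submodule.mem_bot k).1 hx]; simp, inferInstance⟩⟩

instance (N : RightComod k Γ) : IsDirectedOrder N.FDSub where
  directed p q := by
    have := p.finite
    have := q.finite
    refine ⟨⟨p.space ⊔ q.space, ?_, inferInstance⟩, ?_, ?_⟩
    · intro x hx
      obtain ⟨y, hy, z, hz, rfl⟩ := Submodule.mem_sup.1 hx
      rw [map_add]
      exact add_mem (isSubcomodule_mono le_sup_left (p.isSubcomodule y hy))
        (isSubcomodule_mono le_sup_right (q.isSubcomodule z hz))
    · exact (le_sup_left : p.space ≤ p.space ⊔ q.space)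
    · exact (le_sup_right : q.space ≤ p.space ⊔ q.space)

/-- A finite-dimensional subcomodule, as a comodule. -/
def FDSub.comod {N : RightComod k Γ} (p : N.FDSub) : RightComod k Γ := N.sub p.space p.isSubcomodule

instance {N : RightComod k Γ} (p : N.FDSub) : Module.Finite k p.comod.carrier := p.finite

/-- The inclusion between finite-dimensional subcomodules. -/
def FDSub.incl {N : RightComod k Γ} {p q : N.FDSub} (h : p ≤ q) : homs p.comod q.comod :=
  ⟨Submodule.inclusion (show p.space ≤ q.space from h), by
    have hq := N.subtype_subCoact q.space q.isSubcomodule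
    have hp := N.subtype_subCoact p.space p.isSubcomodule
    have key : N.subCoact q.space q.isSubcomodule ∘ₗ
        Submodule.inclusion (show p.space ≤ q.space from h) =
        (Submodule.inclusion (show p.space ≤ q.space from h)).rTensor Γ ∘ₗ
          N.subCoact p.space p.isSubcomodule := by
      rw [← LinearMap.cancel_left (rTensor_subtype_injective (G := Γ) q.space)]
      rw [← LinearMap.comp_assoc, hq, ← LinearMap.comp_assoc, ← LinearMap.rTensor_comp,
        Submodule.subtype_comp_inclusion, hp]
      rfl
    exact key⟩

/-- The inclusion of a finite-dimensional subcomodule. -/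
def FDSub.toAmbient {N : RightComod k Γ} (p : N.FDSub) : homs p.comod N :=
  ⟨p.space.subtype, (N.subtype_subCoact p.space p.isSubcomodule).symm⟩

/-- Composition of comodule maps, linear in the second one: `Hom(N, P) → Hom(M, P)`. -/
def precomp {M N : RightComod k Γ} (f : homs M N) (P : RightComod k Γ) :
    homs N P →ₗ[k] homs M P where
  toFun g := ⟨g.1 ∘ₗ f.1, comp_mem f g⟩
  map_add' _ _ := rfl
  map_smul' _ _ := rfl

/-- Composition of comodule maps, linear in the first one: `Hom(M, N) → Hom(M, P)`. -/
def postcomp (M : RightComod k Γ) {N P : RightComod k Γ} (g : homs N P) :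
    homs M N →ₗ[k] homs M P where
  toFun f := ⟨g.1 ∘ₗ f.1, comp_mem f g⟩
  map_add' f f' := Subtype.ext (LinearMap.comp_add f.1 f'.1 g.1)
  map_smul' c f := Subtype.ext (LinearMap.comp_smul g.1 c f.1)

open Classical in
/-- The cohom space `h_{-Γ}(M, N)`: the direct limit of the spaces `D Hom_{-Γ}(N', M)`, where `N'`
runs through the finite-dimensional subcomodules of `N`, `D` is the linear dual, and the transition
maps are the duals of the restriction maps. -/
def Cohom (M N : RightComod k Γ) : Type u :=
  Module.DirectLimit (R := k) (fun p : N.FDSub => Module.Dual k (homs p.comod M))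
    (fun _ _ h => (precomp (FDSub.incl h) M).dualMap)

namespace Cohom

open Classical in
instance (M N : RightComod k Γ) : AddCommGroup (Cohom M N) :=
  inferInstanceAs (AddCommGroup (Module.DirectLimit (R := k)
    (fun p : N.FDSub => Module.Dual k (homs p.comod M))
    (fun _ _ h => (precomp (FDSub.incl h) M).dualMap)))

open Classical in
instance (M N : RightComod k Γ) : Module k (Cohom M N) :=
  inferInstanceAs (Module k (Module.DirectLimit (R := k)
    (fun p : N.FDSub => Module.Dual k (homs p.comod M))
    (fun _ _ h => (precomp (FDSub.incl h) M).dualMap)))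

open Classical in
/-- The structure maps of the direct limit. -/
def of (M : RightComod k Γ) {N : RightComod k Γ} (p : N.FDSub) :
    Module.Dual k (homs p.comod M) →ₗ[k] Cohom M N :=
  Module.DirectLimit.of k N.FDSub (fun p : N.FDSub => Module.Dual k (homs p.comod M))
    (fun _ _ h => (precomp (FDSub.incl h) M).dualMap) p

open Classical in
theorem of_dualMap {M N : RightComod k Γ} {p q : N.FDSub} (h : p ≤ q)
    (φ : Module.Dual k (homs p.comod M)) :
    of M q ((precomp (FDSub.incl h) M).dualMap φ) = of M p φ :=
  Module.DirectLimit.of_f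

open Classical in
theorem exists_of {M N : RightComod k Γ} (z : Cohom M N) :
    ∃ (p : N.FDSub) (φ : _), of M p φ = z := Module.DirectLimit.exists_of z

open Classical in
/-- The universal property of the direct limit. -/
def desc {M N : RightComod k Γ} {W : Type u} [AddCommGroup W] [Module k W]
    (g : ∀ p : N.FDSub, Module.Dual k (homs p.comod M) →ₗ[k] W)
    (hg : ∀ (p q : N.FDSub) (h : p ≤ q) (φ : Module.Dual k (homs p.comod M)),
      g q ((precomp (FDSub.incl h) M).dualMap φ) = g p φ) : Cohom M N →ₗ[k] W :=
  Module.DirectLimit.lift k N.FDSub (fun p : N.FDSub => Module.Dual k (homs p.comod M))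
    (fun _ _ h => (precomp (FDSub.incl h) M).dualMap) g hg

open Classical in
@[simp] theorem desc_of {M N : RightComod k Γ} {W : Type u} [AddCommGroup W] [Module k W]
    (g : ∀ p : N.FDSub, Module.Dual k (homs p.comod M) →ₗ[k] W)
    (hg : ∀ (p q : N.FDSub) (h : p ≤ q) (φ : Module.Dual k (homs p.comod M)),
      g q ((precomp (FDSub.incl h) M).dualMap φ) = g p φ) (p : N.FDSub) (φ) :
    desc g hg (of M p φ) = g p φ := by
  exact Module.DirectLimit.lift_of _ _ _

theorem hom_ext {M N : RightComod k Γ} {W : Type u} [AddCommGroup W] [Module k W]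
    {f g : Cohom M N →ₗ[k] W} (h : ∀ p φ, f (of M p φ) = g (of M p φ)) : f = g := by
  ext z
  obtain ⟨p, φ, rfl⟩ := exists_of z
  exact h p φ

/-- The contravariant action of a comodule map `f : M → M'` on cohom: the map
`h_{-Γ}(M', N) → h_{-Γ}(M, N)` induced by the duals of `Hom(N', M) → Hom(N', M')`. -/
def map {M M' : RightComod k Γ} (f : homs M M') (N : RightComod k Γ) :
    Cohom M' N →ₗ[k] Cohom M N :=
  desc (fun p => of M p ∘ₗ (postcomp p.comod f).dualMap) fun _ _ h φ => by
    simp only [LinearMap.comp_apply]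
    rw [← of_dualMap h]
    rfl

@[simp] theorem map_of {M M' : RightComod k Γ} (f : homs M M') (N : RightComod k Γ)
    (p : N.FDSub) (φ) : map f N (of M' p φ) = of M p ((postcomp p.comod f).dualMap φ) :=
  desc_of _ _ p φ

end Cohom

/-- The left components of `N.coact x`, a finite-dimensional subcomodule containing `x`. -/
def genMap (N : RightComod k Γ) (x : N.carrier) : Module.Dual k Γ →ₗ[k] N.carrier where
  toFun φ := TensorProduct.rid k N.carrier (φ.lTensor N.carrier (N.coact x))
  map_add' φ ψ := by rw [LinearMap.lTensor_add, LinearMap.add_apply, map_add]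
  map_smul' c φ := by rw [LinearMap.lTensor_smul, LinearMap.smul_apply, map_smul]; rfl

theorem finite_range_genMap (N : RightComod k Γ) (x : N.carrier) :
    Module.Finite k (LinearMap.range (N.genMap x)) := by
  classical
  obtain ⟨S, hS⟩ := TensorProduct.exists_finset (R := k) (N.coact x)
  have : LinearMap.range (N.genMap x) ≤ Submodule.span k (S.image Prod.fst : Set N.carrier) := by
    rintro _ ⟨φ, rfl⟩
    change TensorProduct.rid k N.carrier (φ.lTensor N.carrier (N.coact x)) ∈ _
    rw [hS, map_sum, map_sum]
    refine Submodule.sum_mem _ fun i hi => ?_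
    rw [LinearMap.lTensor_tmul, TensorProduct.rid_tmul]
    exact Submodule.smul_mem _ _ (Submodule.subset_span (by
      simp only [Finset.coe_image]; exact ⟨i, hi, rfl⟩))
  exact Submodule.finiteDimensional_of_le this

theorem isSubcomodule_range_genMap (N : RightComod k Γ) (x : N.carrier) :
    N.IsSubcomodule (LinearMap.range (N.genMap x)) := by
  rintro _ ⟨φ, rfl⟩
  refine mem_range_rTensor_of_forall _ _ fun ψ => ?_
  refine ⟨(TensorProduct.lid k k).toLinearMap ∘ₗ TensorProduct.map φ ψ ∘ₗ
    (TensorProduct.comm k Γ Γ).toLinearMap ∘ₗ comul, ?_⟩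
  have key : ∀ t : N.carrier ⊗[k] Γ, TensorProduct.rid k N.carrier (ψ.lTensor N.carrier (N.coact
      (TensorProduct.rid k N.carrier (φ.lTensor N.carrier t)))) =
      TensorProduct.rid k N.carrier (((TensorProduct.lid k k).toLinearMap ∘ₗ
        TensorProduct.map φ ψ ∘ₗ (TensorProduct.comm k Γ Γ).toLinearMap).lTensor N.carrier
        (TensorProduct.assoc k N.carrier Γ Γ (N.coact.rTensor Γ t))) := by
    intro t
    induction t with
    | zero => simp
    | add a b ha hb => simp only [map_add, ha, hb]
    | tmul n g =>
      simp only [LinearMap.lTensor_tmul, TensorProduct.rid_tmul, map_smul, LinearMap.rTensor_tmul]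
      induction N.coact n with
      | zero => simp
      | add a b ha hb => simp only [map_add, smul_add, ha, hb, add_tmul]
      | tmul m g' => simp [smul_smul]
  have hco := LinearMap.congr_fun N.coassoc x
  simp only [LinearMap.comp_apply, LinearEquiv.coe_coe] at hco
  change TensorProduct.rid k N.carrier (_) = TensorProduct.rid k N.carrier (ψ.lTensor N.carrier
    (N.coact (TensorProduct.rid k N.carrier (φ.lTensor N.carrier (N.coact x)))))
  rw [key, hco, ← LinearMap.comp_apply (LinearMap.lTensor N.carrier _) (LinearMap.lTensor _ _),
    ← LinearMap.lTensor_comp]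
  rfl

/-- The finite-dimensional subcomodule generated by `x`. -/
def gen (N : RightComod k Γ) (x : N.carrier) : N.FDSub :=
  ⟨LinearMap.range (N.genMap x), N.isSubcomodule_range_genMap x, N.finite_range_genMap x⟩

theorem mem_gen (N : RightComod k Γ) (x : N.carrier) : x ∈ (N.gen x).space := by
  refine ⟨counit, ?_⟩
  have := LinearMap.congr_fun N.counit_coact x
  simp only [LinearMap.comp_apply] at this
  change TensorProduct.rid k N.carrier (_) = x
  rw [this]
  simp

namespace Cohom

theorem finite_homs {M : RightComod k Γ} (hM : IsQuasifinite M) (F : RightComod k Γ)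
    [h : Module.Finite k F.carrier] : Module.Finite k (homs F M) := hM F h

/-- An element of a finite-dimensional subcomodule. -/
def elem {N : RightComod k Γ} (p : N.FDSub) (x : N.carrier) (hx : x ∈ p.space) : p.comod.carrier :=
  ⟨x, hx⟩

/-- The canonical map `p → D Hom(p, M) ⊗ M`, for `Hom(p, M)` finite-dimensional: it corresponds
to the evaluation under `D Hom(p, M) ⊗ M ≅ Hom_k (Hom(p, M), M)`. -/
def coevAux {M P : RightComod k Γ} (h : Module.Finite k (homs P M)) :
    P.carrier →ₗ[k] Module.Dual k (homs P M) ⊗[k] M.carrier :=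
  (dualTensorHomEquiv k (homs P M) M.carrier).symm.toLinearMap ∘ₗ
    (homs P M).subtype.flip

theorem slice_coevAux {M P : RightComod k Γ} (h : Module.Finite k (homs P M)) (f : homs P M)
    (x : P.carrier) :
    slice M.carrier (Module.Dual.eval k (homs P M) f) (coevAux h x) = f.1 x := by
  have h1 : ∀ t : Module.Dual k (homs P M) ⊗[k] M.carrier,
      slice M.carrier (Module.Dual.eval k (homs P M) f) t = dualTensorHomEquiv k _ _ t f := by
    intro t
    induction t with
    | zero => simp
    | tmul v m => simp [dualTensorHomEquiv]
    | add x y hx hy => simp only [map_add, hx, hy, LinearMap.add_apply]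
  rw [h1, coevAux, LinearMap.comp_apply, LinearEquiv.coe_coe, LinearEquiv.apply_symm_apply]
  rfl

/-- Equality in `D H ⊗ M`, with `H` finite-dimensional, is tested on the elements of `H`. -/
theorem slice_eval_ext {H M : Type u} [AddCommGroup H] [Module k H] [Module.Finite k H]
    [AddCommGroup M] [Module k M] {s t : Module.Dual k H ⊗[k] M}
    (h : ∀ f : H, slice M (Module.Dual.eval k H f) s = slice M (Module.Dual.eval k H f) t) :
    s = t := by
  refine slice_ext fun φ => ?_
  obtain ⟨f, rfl⟩ := (Module.evalEquiv k H).surjective φ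
  exact h f

theorem coevAux_natural {M P Q : RightComod k Γ} (hP : Module.Finite k (homs P M))
    (hQ : Module.Finite k (homs Q M)) (i : homs P Q) (x : P.carrier) :
    (precomp i M).dualMap.rTensor M.carrier (coevAux hP x) = coevAux hQ (i.1 x) := by
  refine slice_eval_ext fun f => ?_
  rw [slice_rTensor, slice_coevAux]
  exact slice_coevAux hP (precomp i M f) x

variable {M : RightComod k Γ} (hM : IsQuasifinite M)

/-- The component of the canonical map `N → h_{-Γ}(M, N) ⊗ M` on a finite-dimensional
subcomodule. -/
def coevOn {N : RightComod k Γ} (p : N.FDSub) :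
    p.comod.carrier →ₗ[k] Cohom M N ⊗[k] M.carrier :=
  (of M p).rTensor M.carrier ∘ₗ coevAux (finite_homs hM p.comod)

theorem coevOn_incl {N : RightComod k Γ} {p q : N.FDSub} (h : p ≤ q) (x : p.comod.carrier) :
    coevOn hM q ((FDSub.incl h).1 x) = coevOn hM p x := by
  have e : of M p = of M q ∘ₗ (precomp (FDSub.incl h) M).dualMap := by
    ext φ
    exact (of_dualMap h φ).symm
  rw [coevOn, coevOn, LinearMap.comp_apply, LinearMap.comp_apply, e, LinearMap.rTensor_comp,
    LinearMap.comp_apply, coevAux_natural _ (finite_homs hM q.comod)]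

theorem coevOn_congr {N : RightComod k Γ} (p q : N.FDSub) (x : N.carrier) (hp : x ∈ p.space)
    (hq : x ∈ q.space) : coevOn hM p (elem p x hp) = coevOn hM q (elem q x hq) := by
  obtain ⟨r, hpr, hqr⟩ := exists_ge_ge p q
  rw [← coevOn_incl hM hpr, ← coevOn_incl hM hqr]
  rfl

/-- The canonical map `N → h_{-Γ}(M, N) ⊗ M` for `M` quasifinite. -/
def coev (N : RightComod k Γ) : N.carrier →ₗ[k] Cohom M N ⊗[k] M.carrier where
  toFun x := coevOn hM (N.gen x) (elem _ x (N.mem_gen x))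
  map_add' x y := by
    obtain ⟨r, hr, hr'⟩ := exists_ge_ge (N.gen x) (N.gen y)
    have hx : x ∈ r.space := (show (N.gen x).space ≤ r.space from hr) (N.mem_gen x)
    have hy : y ∈ r.space := (show (N.gen y).space ≤ r.space from hr') (N.mem_gen y)
    rw [coevOn_congr hM _ r _ _ (add_mem hx hy), coevOn_congr hM _ r _ _ hx,
      coevOn_congr hM _ r _ _ hy, ← map_add]
    rfl
  map_smul' c x := by
    have hx := N.mem_gen x
    rw [coevOn_congr hM _ (N.gen x) _ _ (Submodule.smul_mem _ c hx), RingHom.id_apply,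
      ← map_smul]
    rfl

theorem coev_of_mem {N : RightComod k Γ} (p : N.FDSub) (x : p.comod.carrier) :
    coev hM N (p.toAmbient.1 x) =
      (of M p).rTensor M.carrier (coevAux (finite_homs hM p.comod) x) :=
  coevOn_congr hM _ p _ _ x.2

/-- The canonical map is a comodule map. -/
theorem coev_colinear (N : RightComod k Γ) :
    (TensorProduct.assoc k (Cohom M N) M.carrier Γ).symm.toLinearMap ∘ₗ
      M.coact.lTensor (Cohom M N) ∘ₗ coev hM N = (coev hM N).rTensor Γ ∘ₗ N.coact := by
  ext x
  obtain ⟨p, y, rfl⟩ : ∃ (p : N.FDSub) (y : p.comod.carrier), p.toAmbient.1 y = x :=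
    ⟨N.gen x, ⟨x, N.mem_gen x⟩, rfl⟩
  simp only [LinearMap.comp_apply, LinearEquiv.coe_coe]
  have e : coev hM N ∘ₗ p.toAmbient.1 = (of M p).rTensor M.carrier ∘ₗ
      coevAux (finite_homs hM p.comod) := LinearMap.ext fun x => coev_of_mem hM p x
  rw [coev_of_mem, homs_apply, ← LinearMap.rTensor_comp_apply Γ (coev hM N) p.toAmbient.1, e]
  have hf := finite_homs hM p.comod
  have key : (TensorProduct.assoc k _ M.carrier Γ).symm (M.coact.lTensor _ (coevAux hf y)) =
      (coevAux hf).rTensor Γ (p.comod.coact y) := by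
    apply (TensorProduct.assoc k _ M.carrier Γ).injective
    refine slice_eval_ext fun f => ?_
    rw [LinearEquiv.apply_symm_apply, slice_lTensor, slice_coevAux, homs_apply,
      ← slice_assoc_symm, LinearEquiv.symm_apply_apply, ← LinearMap.rTensor_comp_apply]
    have hs : slice M.carrier (Module.Dual.eval k _ f) ∘ₗ coevAux hf = f.1 :=
      LinearMap.ext fun z => slice_coevAux hf f z
    rw [hs]
  have nat : ∀ t, (TensorProduct.assoc k _ M.carrier Γ).symm (M.coact.lTensor _
      ((of M p).rTensor M.carrier t)) = ((of M p).rTensor M.carrier).rTensor Γ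
        ((TensorProduct.assoc k _ M.carrier Γ).symm (M.coact.lTensor _ t)) := by
    intro t
    induction t with
    | zero => simp
    | add a b ha hb => simp only [map_add, ha, hb]
    | tmul a m =>
      simp only [LinearMap.rTensor_tmul, LinearMap.lTensor_tmul]
      induction M.coact m with
      | zero => simp
      | add a b ha hb => simp only [map_add, tmul_add, ha, hb]
      | tmul a b => simp
  rw [nat, key, LinearMap.rTensor_comp, LinearMap.comp_apply]

/-- Uniqueness in the universal property of cohom. -/
theorem lift_unique {N : RightComod k Γ} {W : Type u} [AddCommGroup W] [Module k W]
    {u v : Cohom M N →ₗ[k] W}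
    (h : u.rTensor M.carrier ∘ₗ coev hM N = v.rTensor M.carrier ∘ₗ coev hM N) : u = v := by
  refine hom_ext fun p φ => ?_
  rw [← sub_eq_zero, ← Module.forall_dual_apply_eq_zero_iff k]
  intro w
  have hf := finite_homs hM p.comod
  obtain ⟨f, hfe⟩ := (Module.evalEquiv k (homs p.comod M)).surjective
    (w ∘ₗ (u - v) ∘ₗ of M p)
  have hfe : Module.Dual.eval k _ f = w ∘ₗ (u - v) ∘ₗ of M p := hfe
  have hz : f = 0 := by
    ext x
    rw [← slice_coevAux hf f x, hfe, ← slice_rTensor, LinearMap.rTensor_comp, LinearMap.comp_apply,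
      ← coev_of_mem hM, LinearMap.rTensor_sub, LinearMap.sub_apply]
    have := LinearMap.congr_fun h (p.toAmbient.1 x)
    simp only [LinearMap.comp_apply] at this
    rw [this, sub_self]
    simp
  have := LinearMap.congr_fun hfe φ
  rw [hz, map_zero] at this
  exact this.symm

/-- The comodule map `N → M` obtained from a comodule map `N → W ⊗ M` and a functional on `W`. -/
def sliceHom {M N : RightComod k Γ} {W : Type u} [AddCommGroup W] [Module k W]
    (g : N.carrier →ₗ[k] W ⊗[k] M.carrier)
    (hg : (TensorProduct.assoc k W M.carrier Γ).symm.toLinearMap ∘ₗ M.coact.lTensor W ∘ₗ g =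
      g.rTensor Γ ∘ₗ N.coact) : Module.Dual k W →ₗ[k] homs N M where
  toFun w := ⟨slice M.carrier w ∘ₗ g, by
    rw [mem_homs, LinearMap.rTensor_comp, LinearMap.comp_assoc, ← hg]
    ext x
    simp only [LinearMap.comp_apply, LinearEquiv.coe_coe]
    rw [slice_assoc_symm, slice_lTensor]⟩
  map_add' a b := by
    ext x
    simp [slice, LinearMap.rTensor_add]
  map_smul' a b := by
    ext x
    simp [slice, LinearMap.rTensor_smul]

/-- Existence in the universal property of cohom. -/
theorem exists_lift {N : RightComod k Γ} {W : Type u} [AddCommGroup W] [Module k W]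
    (g : N.carrier →ₗ[k] W ⊗[k] M.carrier)
    (hg : (TensorProduct.assoc k W M.carrier Γ).symm.toLinearMap ∘ₗ M.coact.lTensor W ∘ₗ g =
      g.rTensor Γ ∘ₗ N.coact) :
    ∃ u : Cohom M N →ₗ[k] W, u.rTensor M.carrier ∘ₗ coev hM N = g := by
  let u' : Cohom M N →ₗ[k] Module.Dual k (Module.Dual k W) :=
    desc (fun p => (precomp p.toAmbient M ∘ₗ sliceHom g hg).dualMap) fun _ _ _ _ => rfl
  have hd : ∀ p φ w, u' (of M p φ) w = φ (precomp p.toAmbient M (sliceHom g hg w)) := by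
    intro p φ w
    have := desc_of (fun p => (precomp p.toAmbient M ∘ₗ sliceHom g hg).dualMap)
      (fun _ _ _ _ => rfl) p φ
    exact LinearMap.congr_fun this w
  have hu' : ∀ z, u' z ∈ LinearMap.range (Module.Dual.eval k W) := by
    intro z
    obtain ⟨p, φ, rfl⟩ := exists_of z
    have := p.finite
    obtain ⟨ψ, hψ⟩ := LinearMap.exists_extend φ
    let b := Module.finBasis k p.comod.carrier
    let L : Fin _ → M.carrier →ₗ[k] k := fun j => ψ ∘ₗ LinearMap.smulRightₗ (b.coord j)
    refine ⟨∑ j, TensorProduct.rid k W ((L j).lTensor W (g (p.toAmbient.1 (b j)))), ?_⟩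
    ext w
    rw [Module.Dual.eval_apply, map_sum]
    rw [hd]
    have e2 : ∀ f : homs p.comod M, φ f = ψ f.1 := fun f => (LinearMap.congr_fun hψ f).symm
    rw [e2]
    simp_rw [slice_rid]
    simp only [L, LinearMap.comp_apply]
    rw [← map_sum]
    congr 1
    refine b.ext fun i => ?_
    rw [LinearMap.sum_apply]
    simp only [LinearMap.smulRightₗ_apply_apply, Module.Basis.coord_apply, Module.Basis.repr_self]
    rw [Finset.sum_eq_single i]
    · simp only [Finsupp.single_eq_same, one_smul]
      rfl
    · intro j _ hj
      rw [Finsupp.single_eq_of_ne hj, zero_smul]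
    · simp
  let ev := LinearEquiv.ofInjective (Module.Dual.eval k W) (Module.eval_apply_injective k)
  refine ⟨ev.symm.toLinearMap ∘ₗ u'.codRestrict _ hu', ?_⟩
  ext x
  obtain ⟨p, y, rfl⟩ : ∃ (p : N.FDSub) (y : p.comod.carrier), p.toAmbient.1 y = x :=
    ⟨N.gen x, ⟨x, N.mem_gen x⟩, rfl⟩
  refine slice_ext fun w => ?_
  rw [LinearMap.comp_apply, slice_rTensor, coev_of_mem, slice_rTensor]
  have e : (w ∘ₗ ev.symm.toLinearMap ∘ₗ u'.codRestrict _ hu') ∘ₗ of M p =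
      Module.Dual.eval k _ (precomp p.toAmbient M (sliceHom g hg w)) := by
    ext φ
    have h1 : ∀ y, w (ev.symm y) = y.1 w := by
      intro y
      obtain ⟨z, rfl⟩ := ev.surjective y
      rw [LinearEquiv.symm_apply_apply]
      rfl
    simp only [LinearMap.comp_apply, LinearEquiv.coe_coe]
    rw [h1, LinearMap.codRestrict_apply]
    exact hd p φ w
  rw [e, slice_coevAux]
  rfl

/-- The map out of cohom given by its universal property. -/
def lift {N : RightComod k Γ} {W : Type u} [AddCommGroup W] [Module k W]
    (g : N.carrier →ₗ[k] W ⊗[k] M.carrier)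
    (hg : (TensorProduct.assoc k W M.carrier Γ).symm.toLinearMap ∘ₗ M.coact.lTensor W ∘ₗ g =
      g.rTensor Γ ∘ₗ N.coact) : Cohom M N →ₗ[k] W := (exists_lift hM g hg).choose

theorem lift_coev {N : RightComod k Γ} {W : Type u} [AddCommGroup W] [Module k W]
    (g : N.carrier →ₗ[k] W ⊗[k] M.carrier)
    (hg : (TensorProduct.assoc k W M.carrier Γ).symm.toLinearMap ∘ₗ M.coact.lTensor W ∘ₗ g =
      g.rTensor Γ ∘ₗ N.coact) : (lift hM g hg).rTensor M.carrier ∘ₗ coev hM N = g :=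
  (exists_lift hM g hg).choose_spec

/-- The functoriality of cohom is compatible with the canonical maps. -/
theorem map_coev {M' : RightComod k Γ} (hM' : IsQuasifinite M') (f : homs M M')
    (N : RightComod k Γ) :
    (map f N).rTensor M'.carrier ∘ₗ coev hM' N = f.1.lTensor (Cohom M N) ∘ₗ coev hM N := by
  ext x
  obtain ⟨p, y, rfl⟩ : ∃ (p : N.FDSub) (y : p.comod.carrier), p.toAmbient.1 y = x :=
    ⟨N.gen x, ⟨x, N.mem_gen x⟩, rfl⟩
  have hf := finite_homs hM p.comod
  have hf' := finite_homs hM' p.comod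
  have e : map f N ∘ₗ of M' p = of M p ∘ₗ (postcomp p.comod f).dualMap :=
    LinearMap.ext fun φ => map_of f N p φ
  rw [LinearMap.comp_apply, LinearMap.comp_apply, coev_of_mem, coev_of_mem,
    ← LinearMap.comp_apply, ← LinearMap.rTensor_comp, e, LinearMap.rTensor_comp,
    LinearMap.comp_apply, ← LinearMap.comp_apply (LinearMap.lTensor _ _),
    LinearMap.lTensor_comp_rTensor, ← LinearMap.rTensor_comp_lTensor, LinearMap.comp_apply]
  congr 1
  refine slice_eval_ext fun g => ?_
  rw [slice_rTensor, slice_lTensor, slice_coevAux]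
  exact slice_coevAux hf' (postcomp p.comod f g) y

/-- The canonical map `θ : Γ → h_{-Γ}(M, Γ) ⊗ M` for `M` quasifinite. -/
def theta : Γ →ₗ[k] Cohom M (regular k Γ) ⊗[k] M.carrier := coev hM (regular k Γ)

theorem theta_unique {W : Type u} [AddCommGroup W] [Module k W]
    {u v : Cohom M (regular k Γ) →ₗ[k] W}
    (h : u.rTensor M.carrier ∘ₗ theta hM = v.rTensor M.carrier ∘ₗ theta hM) : u = v :=
  lift_unique hM h

/-- The map `Γ → (Γ ⊗ h) ⊗ M`, `w ↦ ∑ w₁ ⊗ θ(w₂)`. -/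
def thetaComul : Γ →ₗ[k] (Γ ⊗[k] Cohom M (regular k Γ)) ⊗[k] M.carrier :=
  (TensorProduct.assoc k Γ (Cohom M (regular k Γ)) M.carrier).symm.toLinearMap ∘ₗ
    (theta hM).lTensor Γ ∘ₗ comul

/-- The left coaction `λ : h → Γ ⊗ h` on `h = h_{-Γ}(M, Γ)` that is induced by the left comodule
structure of `Γ`: it is the unique linear map with `∑ λ(θ(w)₀) ⊗ θ(w)₁ = ∑ w₁ ⊗ θ(w₂)` for all
`w ∈ Γ`, where `θ(w) = ∑ θ(w)₀ ⊗ θ(w)₁ ∈ h ⊗ M`. -/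
def leftCoact : Cohom M (regular k Γ) →ₗ[k] Γ ⊗[k] Cohom M (regular k Γ) :=
  lift hM (N := regular k Γ) (thetaComul hM)
    (coactAux_colinear M.coact (theta hM) (coev_colinear hM (regular k Γ)))

theorem leftCoact_theta :
    (leftCoact hM).rTensor M.carrier ∘ₗ theta hM =
      (TensorProduct.assoc k Γ (Cohom M (regular k Γ)) M.carrier).symm.toLinearMap ∘ₗ
        (theta hM).lTensor Γ ∘ₗ comul :=
  lift_coev hM (N := regular k Γ) (thetaComul hM) _

theorem leftCoact_coassoc :
    (TensorProduct.assoc k Γ Γ (Cohom M (regular k Γ))).toLinearMap ∘ₗ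
      (comul (R := k) (A := Γ)).rTensor (Cohom M (regular k Γ)) ∘ₗ leftCoact hM =
    (leftCoact hM).lTensor Γ ∘ₗ leftCoact hM :=
  theta_unique hM (coassocAux _ _ (leftCoact_theta hM))

theorem leftCoact_counit :
    (counit (R := k) (A := Γ)).rTensor (Cohom M (regular k Γ)) ∘ₗ leftCoact hM =
    TensorProduct.mk k k (Cohom M (regular k Γ)) 1 :=
  theta_unique hM (counitAux _ _ (leftCoact_theta hM))

/-- The maps induced on `h_{-Γ}(-, Γ)` are maps of left comodules. -/
theorem leftCoact_map {M' : RightComod k Γ} (hM' : IsQuasifinite M') (f : homs M M') :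
    leftCoact hM ∘ₗ map f (regular k Γ) =
      (map f (regular k Γ)).lTensor Γ ∘ₗ leftCoact hM' :=
  theta_unique hM' (mapAux f.1 _ _ _ _ _ (leftCoact_theta hM) (leftCoact_theta hM')
    (map_coev hM hM' f (regular k Γ)))

theorem map_id (M N : RightComod k Γ) :
    map (⟨LinearMap.id, by simp [mem_homs]⟩ : homs M M) N = LinearMap.id :=
  hom_ext fun p φ => by
    rw [map_of]
    rfl

theorem map_comp {M M' M'' N : RightComod k Γ} (f : homs M M') (g : homs M' M'') :
    map (⟨g.1 ∘ₗ f.1, comp_mem f g⟩ : homs M M'') N = map f N ∘ₗ map g N :=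
  hom_ext fun p φ => by
    rw [map_of, LinearMap.comp_apply, map_of, map_of]
    rfl

end Cohom

end RightComod

namespace LeftComod

/-- `Hom_{Γ-}(M, N)`: the space of left comodule maps `M → N`. -/
def homs (M N : LeftComod k Γ) : Submodule k (M.carrier →ₗ[k] N.carrier) where
  carrier := {f | N.coact ∘ₗ f = f.lTensor Γ ∘ₗ M.coact}
  zero_mem' := by simp
  add_mem' := by
    intro f g hf hg
    change _ = _ at hf hg
    change _ = _
    rw [LinearMap.comp_add, hf, hg, LinearMap.lTensor_add, LinearMap.add_comp]
  smul_mem' := by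
    intro c f hf
    change _ = _ at hf
    change _ = _
    rw [LinearMap.comp_smul, hf, LinearMap.lTensor_smul, LinearMap.smul_comp]

theorem mem_homs {M N : LeftComod k Γ} {f : M.carrier →ₗ[k] N.carrier} :
    f ∈ homs M N ↔ N.coact ∘ₗ f = f.lTensor Γ ∘ₗ M.coact := Iff.rfl

theorem comp_mem {M N P : LeftComod k Γ} (f : homs M N) (g : homs N P) :
    g.1 ∘ₗ f.1 ∈ homs M P := by
  rw [mem_homs, ← LinearMap.comp_assoc, mem_homs.1 g.2, LinearMap.comp_assoc, mem_homs.1 f.2,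
    ← LinearMap.comp_assoc, ← LinearMap.lTensor_comp]

/-- The category of left `Γ`-comodules. -/
instance : Category (LeftComod k Γ) where
  Hom M N := homs M N
  id M := ⟨LinearMap.id, by simp [mem_homs]⟩
  comp f g := ⟨g.1 ∘ₗ f.1, comp_mem f g⟩

/-- `M` is quasifinite if `Hom_{Γ-}(F, M)` is finite-dimensional for all finite-dimensional `F`. -/
def IsQuasifinite : ObjectProperty (LeftComod k Γ) := fun M =>
  ∀ F : LeftComod k Γ, Module.Finite k F.carrier → Module.Finite k (homs F M)

/-- Quasifinite and injective. -/
def IsQuasifiniteInjective : ObjectProperty (LeftComod k Γ) := fun M =>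
  IsQuasifinite M ∧ Injective M

end LeftComod

namespace RightComod

/-- The contravariant functor `* = h_{-Γ}(-, Γ)` from quasifinite right comodules to left
comodules. -/
def star : (IsQuasifinite (k := k) (Γ := Γ)).FullSubcategoryᵒᵖ ⥤ LeftComod k Γ where
  obj M :=
    { carrier := Cohom M.unop.obj (regular k Γ)
      coact := Cohom.leftCoact M.unop.property
      coassoc := Cohom.leftCoact_coassoc M.unop.property
      counit_coact := Cohom.leftCoact_counit M.unop.property }
  map {M N} f := ⟨Cohom.map f.unop.hom (regular k Γ),
    Cohom.leftCoact_map N.unop.property M.unop.property f.unop.hom⟩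
  map_id M := Subtype.ext (Cohom.map_id M.unop.obj (regular k Γ))
  map_comp f g := Subtype.ext (Cohom.map_comp g.unop.hom f.unop.hom)

end RightComod

/-- The coopposite coalgebra `Γ^{cop}`: the vector space `Γ` with the comultiplication
`c ↦ ∑ c₂ ⊗ c₁`. -/
def Cop (Γ : Type u) : Type u := Γ

namespace Cop

instance : AddCommGroup (Cop Γ) := inferInstanceAs (AddCommGroup Γ)
instance : Module k (Cop Γ) := inferInstanceAs (Module k Γ)

variable (k Γ) in
/-- The identity, as a map `Γ → Γ^{cop}`. -/
def of : Γ ≃ₗ[k] Cop Γ := LinearEquiv.refl k Γ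

theorem coassocAux :
    (TensorProduct.assoc k Γ Γ Γ).toLinearMap ∘ₗ
      ((TensorProduct.comm k Γ Γ).toLinearMap ∘ₗ comul).rTensor Γ ∘ₗ
        (TensorProduct.comm k Γ Γ).toLinearMap ∘ₗ comul =
    ((TensorProduct.comm k Γ Γ).toLinearMap ∘ₗ (comul (R := k) (A := Γ))).lTensor Γ ∘ₗ
        (TensorProduct.comm k Γ Γ).toLinearMap ∘ₗ comul := by
  -- the reversal `a ⊗ (b ⊗ c) ↦ c ⊗ (b ⊗ a)`
  let σ : Γ ⊗[k] (Γ ⊗[k] Γ) →ₗ[k] Γ ⊗[k] (Γ ⊗[k] Γ) :=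
    (TensorProduct.assoc k Γ Γ Γ).toLinearMap ∘ₗ
      (TensorProduct.comm k Γ (Γ ⊗[k] Γ)).toLinearMap ∘ₗ
        (TensorProduct.comm k Γ Γ).toLinearMap.lTensor Γ
  have e1 : (TensorProduct.assoc k Γ Γ Γ).toLinearMap ∘ₗ
      ((TensorProduct.comm k Γ Γ).toLinearMap ∘ₗ comul).rTensor Γ ∘ₗ
        (TensorProduct.comm k Γ Γ).toLinearMap =
      σ ∘ₗ (comul (R := k) (A := Γ)).lTensor Γ := by
    ext a b
    simp [σ]
  have e2 : ((TensorProduct.comm k Γ Γ).toLinearMap ∘ₗ (comul (R := k) (A := Γ))).lTensor Γ ∘ₗ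
        (TensorProduct.comm k Γ Γ).toLinearMap =
      σ ∘ₗ (TensorProduct.assoc k Γ Γ Γ).toLinearMap ∘ₗ (comul (R := k) (A := Γ)).rTensor Γ := by
    ext a b
    simp only [σ, AlgebraTensorModule.curry_apply, curry_apply, LinearMap.restrictScalars_apply,
      LinearMap.comp_apply, LinearEquiv.coe_coe, TensorProduct.comm_tmul,
      LinearMap.lTensor_tmul, LinearMap.rTensor_tmul]
    induction comul (R := k) a with
    | zero => simp
    | add x y hx hy => simp only [map_add, tmul_add, add_tmul, hx, hy]
    | tmul x y => simp
  calc _ = ((TensorProduct.assoc k Γ Γ Γ).toLinearMap ∘ₗ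
      ((TensorProduct.comm k Γ Γ).toLinearMap ∘ₗ comul).rTensor Γ ∘ₗ
        (TensorProduct.comm k Γ Γ).toLinearMap) ∘ₗ comul := rfl
    _ = σ ∘ₗ (comul (R := k) (A := Γ)).lTensor Γ ∘ₗ comul := by rw [e1]; rfl
    _ = (σ ∘ₗ (TensorProduct.assoc k Γ Γ Γ).toLinearMap ∘ₗ
        (comul (R := k) (A := Γ)).rTensor Γ) ∘ₗ comul := by rw [← Coalgebra.coassoc]; rfl
    _ = _ := by rw [← e2]; rfl

theorem rTensor_counitAux :
    (counit (R := k) (A := Γ)).rTensor Γ ∘ₗ (TensorProduct.comm k Γ Γ).toLinearMap ∘ₗ comul =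
      TensorProduct.mk k k Γ 1 := by
  have e : (counit (R := k) (A := Γ)).rTensor Γ ∘ₗ (TensorProduct.comm k Γ Γ).toLinearMap =
      (TensorProduct.comm k Γ k).toLinearMap ∘ₗ (counit (R := k) (A := Γ)).lTensor Γ := by
    ext a b
    simp
  rw [← LinearMap.comp_assoc, e, LinearMap.comp_assoc, Coalgebra.lTensor_counit_comp_comul]
  ext a
  simp

theorem lTensor_counitAux :
    (counit (R := k) (A := Γ)).lTensor Γ ∘ₗ (TensorProduct.comm k Γ Γ).toLinearMap ∘ₗ comul =
      (TensorProduct.mk k Γ k).flip 1 := by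
  have e : (counit (R := k) (A := Γ)).lTensor Γ ∘ₗ (TensorProduct.comm k Γ Γ).toLinearMap =
      (TensorProduct.comm k k Γ).toLinearMap ∘ₗ (counit (R := k) (A := Γ)).rTensor Γ := by
    ext a b
    simp
  rw [← LinearMap.comp_assoc, e, LinearMap.comp_assoc, Coalgebra.rTensor_counit_comp_comul]
  ext a
  simp

instance : Coalgebra k (Cop Γ) where
  comul := ((TensorProduct.comm k Γ Γ).toLinearMap ∘ₗ comul : Γ →ₗ[k] Γ ⊗[k] Γ)
  counit := (counit : Γ →ₗ[k] k)
  coassoc := coassocAux (k := k) (Γ := Γ)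
  rTensor_counit_comp_comul := rTensor_counitAux (k := k) (Γ := Γ)
  lTensor_counit_comp_comul := lTensor_counitAux (k := k) (Γ := Γ)

/-- `f : A ≃ B` is an anti-isomorphism of coalgebras. -/
structure IsAntiIso {A B : Type u} [AddCommGroup A] [Module k A] [Coalgebra k A]
    [AddCommGroup B] [Module k B] [Coalgebra k B] (f : A ≃ₗ[k] B) : Prop where
  comul : comul ∘ₗ f.toLinearMap = TensorProduct.map f.toLinearMap f.toLinearMap ∘ₗ
    (TensorProduct.comm k A A).toLinearMap ∘ₗ comul
  counit : counit ∘ₗ f.toLinearMap = counit (R := k) (A := A)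

theorem isAntiIso_of : IsAntiIso (of k Γ) where
  comul := by
    have : TensorProduct.map (of k Γ).toLinearMap (of k Γ).toLinearMap = LinearMap.id :=
      TensorProduct.map_id
    rw [this]
    rfl
  counit := rfl

theorem isAntiIso_of_symm : IsAntiIso (of k Γ).symm where
  comul := by
    have : TensorProduct.map (of k Γ).symm.toLinearMap (of k Γ).symm.toLinearMap =
      LinearMap.id := TensorProduct.map_id
    rw [this]
    ext x
    change comul (R := k) (A := Γ) x = (TensorProduct.comm k Γ Γ) ((TensorProduct.comm k Γ Γ)
      (comul (R := k) (A := Γ) x))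
    rw [TensorProduct.comm_comm]
  counit := rfl

section Transport

variable {A B : Type u} [AddCommGroup A] [Module k A] [Coalgebra k A]
    [AddCommGroup B] [Module k B] [Coalgebra k B] {f : A ≃ₗ[k] B}

theorem toRight_coassoc {M : Type u} [AddCommGroup M] [Module k M] (hf : IsAntiIso f)
    (l : M →ₗ[k] A ⊗[k] M)
    (hl : (TensorProduct.assoc k A A M).toLinearMap ∘ₗ (comul (R := k) (A := A)).rTensor M ∘ₗ l =
      l.lTensor A ∘ₗ l) :
    (TensorProduct.assoc k M B B).toLinearMap ∘ₗ
      (f.toLinearMap.lTensor M ∘ₗ (TensorProduct.comm k A M).toLinearMap ∘ₗ l).rTensor B ∘ₗ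
        (f.toLinearMap.lTensor M ∘ₗ (TensorProduct.comm k A M).toLinearMap ∘ₗ l) =
    (comul (R := k) (A := B)).lTensor M ∘ₗ
      (f.toLinearMap.lTensor M ∘ₗ (TensorProduct.comm k A M).toLinearMap ∘ₗ l) := by
  -- the reversal `a ⊗ (b ⊗ m) ↦ m ⊗ (f b ⊗ f a)`
  let σ : A ⊗[k] (A ⊗[k] M) →ₗ[k] M ⊗[k] (B ⊗[k] B) :=
    (TensorProduct.assoc k M B B).toLinearMap ∘ₗ
      (TensorProduct.comm k B (M ⊗[k] B)).toLinearMap ∘ₗ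
        TensorProduct.map f.toLinearMap (f.toLinearMap.lTensor M ∘ₗ
          (TensorProduct.comm k A M).toLinearMap)
  have e1 : (TensorProduct.assoc k M B B).toLinearMap ∘ₗ
      (f.toLinearMap.lTensor M ∘ₗ (TensorProduct.comm k A M).toLinearMap ∘ₗ l).rTensor B ∘ₗ
        f.toLinearMap.lTensor M ∘ₗ (TensorProduct.comm k A M).toLinearMap =
      σ ∘ₗ l.lTensor A := by
    ext a m
    simp [σ]
  have e2 : (comul (R := k) (A := B)).lTensor M ∘ₗ
      f.toLinearMap.lTensor M ∘ₗ (TensorProduct.comm k A M).toLinearMap =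
      σ ∘ₗ (TensorProduct.assoc k A A M).toLinearMap ∘ₗ
        (comul (R := k) (A := A)).rTensor M := by
    rw [← LinearMap.comp_assoc, ← LinearMap.lTensor_comp, hf.comul]
    ext a m
    simp only [σ, AlgebraTensorModule.curry_apply, curry_apply, LinearMap.restrictScalars_apply,
      LinearMap.comp_apply, LinearEquiv.coe_coe, TensorProduct.comm_tmul,
      LinearMap.lTensor_tmul, LinearMap.rTensor_tmul]
    induction comul (R := k) a with
    | zero => simp
    | add x y hx hy => simp only [map_add, tmul_add, add_tmul, hx, hy]
    | tmul x y => simp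
  calc _ = ((TensorProduct.assoc k M B B).toLinearMap ∘ₗ
      (f.toLinearMap.lTensor M ∘ₗ (TensorProduct.comm k A M).toLinearMap ∘ₗ l).rTensor B ∘ₗ
        f.toLinearMap.lTensor M ∘ₗ (TensorProduct.comm k A M).toLinearMap) ∘ₗ l := rfl
    _ = σ ∘ₗ (l.lTensor A ∘ₗ l) := by rw [e1]; rfl
    _ = (σ ∘ₗ (TensorProduct.assoc k A A M).toLinearMap ∘ₗ
        (comul (R := k) (A := A)).rTensor M) ∘ₗ l := by rw [← hl]; rfl
    _ = _ := by rw [← e2]; rfl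

theorem toLeft_coassoc {M : Type u} [AddCommGroup M] [Module k M] (hf : IsAntiIso f)
    (l : M →ₗ[k] M ⊗[k] A)
    (hl : (TensorProduct.assoc k M A A).toLinearMap ∘ₗ l.rTensor A ∘ₗ l =
      (comul (R := k) (A := A)).lTensor M ∘ₗ l) :
    (TensorProduct.assoc k B B M).toLinearMap ∘ₗ (comul (R := k) (A := B)).rTensor M ∘ₗ
        (f.toLinearMap.rTensor M ∘ₗ (TensorProduct.comm k M A).toLinearMap ∘ₗ l) =
    (f.toLinearMap.rTensor M ∘ₗ (TensorProduct.comm k M A).toLinearMap ∘ₗ l).lTensor B ∘ₗ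
      (f.toLinearMap.rTensor M ∘ₗ (TensorProduct.comm k M A).toLinearMap ∘ₗ l) := by
  -- the reversal `m ⊗ (a ⊗ b) ↦ f b ⊗ (f a ⊗ m)`
  let σ : M ⊗[k] (A ⊗[k] A) →ₗ[k] B ⊗[k] (B ⊗[k] M) :=
    (TensorProduct.assoc k B B M).toLinearMap ∘ₗ
      (TensorProduct.comm k M (B ⊗[k] B)).toLinearMap ∘ₗ
        (TensorProduct.map f.toLinearMap f.toLinearMap ∘ₗ
          (TensorProduct.comm k A A).toLinearMap).lTensor M
  have e1 : (f.toLinearMap.rTensor M ∘ₗ (TensorProduct.comm k M A).toLinearMap ∘ₗ l).lTensor B ∘ₗ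
        f.toLinearMap.rTensor M ∘ₗ (TensorProduct.comm k M A).toLinearMap =
      σ ∘ₗ (TensorProduct.assoc k M A A).toLinearMap ∘ₗ l.rTensor A := by
    ext m a
    simp only [σ, AlgebraTensorModule.curry_apply, curry_apply, LinearMap.restrictScalars_apply,
      LinearMap.comp_apply, LinearEquiv.coe_coe, TensorProduct.comm_tmul,
      LinearMap.lTensor_tmul, LinearMap.rTensor_tmul]
    induction l m with
    | zero => simp
    | add x y hx hy => simp only [map_add, tmul_add, add_tmul, hx, hy]
    | tmul x y => simp
  have e2 : (TensorProduct.assoc k B B M).toLinearMap ∘ₗ (comul (R := k) (A := B)).rTensor M ∘ₗ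
        f.toLinearMap.rTensor M ∘ₗ (TensorProduct.comm k M A).toLinearMap =
      σ ∘ₗ (comul (R := k) (A := A)).lTensor M := by
    have e3 : (comul (R := k) (A := B)).rTensor M ∘ₗ f.toLinearMap.rTensor M =
        (TensorProduct.map f.toLinearMap f.toLinearMap ∘ₗ
          (TensorProduct.comm k A A).toLinearMap ∘ₗ comul).rTensor M := by
      rw [← LinearMap.rTensor_comp, hf.comul]
    rw [← LinearMap.comp_assoc (TensorProduct.comm k M A).toLinearMap, e3]
    ext m a
    simp [σ]
  calc _ = ((TensorProduct.assoc k B B M).toLinearMap ∘ₗ (comul (R := k) (A := B)).rTensor M ∘ₗ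
        f.toLinearMap.rTensor M ∘ₗ (TensorProduct.comm k M A).toLinearMap) ∘ₗ l := rfl
    _ = σ ∘ₗ (comul (R := k) (A := A)).lTensor M ∘ₗ l := by rw [e2]; rfl
    _ = (σ ∘ₗ (TensorProduct.assoc k M A A).toLinearMap ∘ₗ l.rTensor A) ∘ₗ l := by
      rw [← hl]; rfl
    _ = _ := by rw [← e1]; rfl

/-- Left comodules over `A` are right comodules over `B`, for an anti-isomorphism `f : A ≃ B`:
the coaction `m ↦ ∑ m₋₁ ⊗ m₀` is turned into `m ↦ ∑ m₀ ⊗ f(m₋₁)`. -/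
def toRightObj (hf : IsAntiIso f) (M : LeftComod k A) : RightComod k B where
  carrier := M.carrier
  coact := f.toLinearMap.lTensor M.carrier ∘ₗ (TensorProduct.comm k A M.carrier).toLinearMap ∘ₗ
    M.coact
  coassoc := toRight_coassoc hf M.coact M.coassoc
  counit_coact := by
    have e : (counit (R := k) (A := B)).lTensor M.carrier ∘ₗ f.toLinearMap.lTensor M.carrier ∘ₗ
        (TensorProduct.comm k A M.carrier).toLinearMap =
        (TensorProduct.comm k k M.carrier).toLinearMap ∘ₗ
          (counit (R := k) (A := A)).rTensor M.carrier := by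
      rw [← LinearMap.comp_assoc, ← LinearMap.lTensor_comp, hf.counit]
      ext a m
      simp
    calc _ = ((counit (R := k) (A := B)).lTensor M.carrier ∘ₗ f.toLinearMap.lTensor M.carrier ∘ₗ
        (TensorProduct.comm k A M.carrier).toLinearMap) ∘ₗ M.coact := rfl
      _ = (TensorProduct.comm k k M.carrier).toLinearMap ∘ₗ
          (counit (R := k) (A := A)).rTensor M.carrier ∘ₗ M.coact := by rw [e]; rfl
      _ = _ := by
        rw [M.counit_coact]
        ext a
        simp

/-- Right comodules over `A` are left comodules over `B`, for an anti-isomorphism `f : A ≃ B`. -/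
def toLeftObj (hf : IsAntiIso f) (M : RightComod k A) : LeftComod k B where
  carrier := M.carrier
  coact := f.toLinearMap.rTensor M.carrier ∘ₗ (TensorProduct.comm k M.carrier A).toLinearMap ∘ₗ
    M.coact
  coassoc := toLeft_coassoc hf M.coact M.coassoc
  counit_coact := by
    have e : (counit (R := k) (A := B)).rTensor M.carrier ∘ₗ f.toLinearMap.rTensor M.carrier ∘ₗ
        (TensorProduct.comm k M.carrier A).toLinearMap =
        (TensorProduct.comm k M.carrier k).toLinearMap ∘ₗ
          (counit (R := k) (A := A)).lTensor M.carrier := by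
      rw [← LinearMap.comp_assoc, ← LinearMap.rTensor_comp, hf.counit]
      ext a m
      simp
    calc _ = ((counit (R := k) (A := B)).rTensor M.carrier ∘ₗ f.toLinearMap.rTensor M.carrier ∘ₗ
        (TensorProduct.comm k M.carrier A).toLinearMap) ∘ₗ M.coact := rfl
      _ = (TensorProduct.comm k M.carrier k).toLinearMap ∘ₗ
          (counit (R := k) (A := A)).lTensor M.carrier ∘ₗ M.coact := by rw [e]; rfl
      _ = _ := by
        rw [M.counit_coact]
        ext a
        simp

theorem toRight_mem {M N : LeftComod k A} (hf : IsAntiIso f) (g : LeftComod.homs M N) :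
    (show M.carrier →ₗ[k] N.carrier from g.1) ∈
      RightComod.homs (toRightObj hf M) (toRightObj hf N) := by
  change (f.toLinearMap.lTensor N.carrier ∘ₗ (TensorProduct.comm k A N.carrier).toLinearMap ∘ₗ
    N.coact) ∘ₗ g.1 = g.1.rTensor B ∘ₗ f.toLinearMap.lTensor M.carrier ∘ₗ
      (TensorProduct.comm k A M.carrier).toLinearMap ∘ₗ M.coact
  have e : g.1.rTensor B ∘ₗ f.toLinearMap.lTensor M.carrier ∘ₗ
      (TensorProduct.comm k A M.carrier).toLinearMap = f.toLinearMap.lTensor N.carrier ∘ₗ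
        (TensorProduct.comm k A N.carrier).toLinearMap ∘ₗ g.1.lTensor A := by
    ext a m
    simp
  calc _ = f.toLinearMap.lTensor N.carrier ∘ₗ (TensorProduct.comm k A N.carrier).toLinearMap ∘ₗ
        (N.coact ∘ₗ g.1) := rfl
    _ = (f.toLinearMap.lTensor N.carrier ∘ₗ
        (TensorProduct.comm k A N.carrier).toLinearMap ∘ₗ g.1.lTensor A) ∘ₗ M.coact := by
      rw [LeftComod.mem_homs.1 g.2]; rfl
    _ = _ := by rw [← e]; rfl

/-- The identification of left comodules over `A` with right comodules over `B`, as a functor. -/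
def toRight (hf : IsAntiIso f) : LeftComod k A ⥤ RightComod k B where
  obj := toRightObj hf
  map g := ⟨g.1, toRight_mem hf g⟩

/-- The identification preserves quasifiniteness. -/
theorem isQuasifinite_toRight (hf : IsAntiIso f) (hf' : IsAntiIso f.symm) (M : LeftComod k A)
    (hM : LeftComod.IsQuasifinite M) : RightComod.IsQuasifinite (toRightObj hf M) := by
  intro F hF
  have h := hM (toLeftObj hf' F) hF
  let G := LeftComod.homs (toLeftObj hf' F) M
  let i : RightComod.homs F (toRightObj hf M) →ₗ[k] G :=
    { toFun := fun g => ⟨g.1, by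
        have hg : (f.toLinearMap.lTensor M.carrier ∘ₗ
          (TensorProduct.comm k A M.carrier).toLinearMap ∘ₗ M.coact) ∘ₗ g.1 =
            g.1.rTensor B ∘ₗ F.coact := g.2
        have e : (f.symm.toLinearMap.rTensor M.carrier ∘ₗ
            (TensorProduct.comm k M.carrier B).toLinearMap) ∘ₗ
            f.toLinearMap.lTensor M.carrier ∘ₗ
              (TensorProduct.comm k A M.carrier).toLinearMap = LinearMap.id := by
          ext a m
          simp
        have e' : (f.symm.toLinearMap.rTensor M.carrier ∘ₗ
            (TensorProduct.comm k M.carrier B).toLinearMap) ∘ₗ g.1.rTensor B =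
            g.1.lTensor A ∘ₗ f.symm.toLinearMap.rTensor F.carrier ∘ₗ
              (TensorProduct.comm k F.carrier B).toLinearMap := by
          apply TensorProduct.ext'
          intro x b
          rfl
        change M.coact ∘ₗ g.1 = g.1.lTensor A ∘ₗ f.symm.toLinearMap.rTensor F.carrier ∘ₗ
          (TensorProduct.comm k F.carrier B).toLinearMap ∘ₗ F.coact
        calc M.coact ∘ₗ g.1 = ((f.symm.toLinearMap.rTensor M.carrier ∘ₗ
            (TensorProduct.comm k M.carrier B).toLinearMap) ∘ₗ
            f.toLinearMap.lTensor M.carrier ∘ₗ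
              (TensorProduct.comm k A M.carrier).toLinearMap) ∘ₗ M.coact ∘ₗ g.1 := by
              rw [e]; rfl
          _ = (f.symm.toLinearMap.rTensor M.carrier ∘ₗ
            (TensorProduct.comm k M.carrier B).toLinearMap) ∘ₗ
              ((f.toLinearMap.lTensor M.carrier ∘ₗ
          (TensorProduct.comm k A M.carrier).toLinearMap ∘ₗ M.coact) ∘ₗ g.1) := rfl
          _ = ((f.symm.toLinearMap.rTensor M.carrier ∘ₗ
            (TensorProduct.comm k M.carrier B).toLinearMap) ∘ₗ g.1.rTensor B) ∘ₗ F.coact := by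
              rw [hg]; rfl
          _ = _ := by rw [e']; rfl⟩
      map_add' := fun _ _ => rfl
      map_smul' := fun _ _ => rfl }
  refine Module.Finite.of_injective i fun a b hab => Subtype.ext ?_
  have : (i a).1 = (i b).1 := by rw [hab]
  exact this

end Transport

end Cop

namespace LeftComod

/-- The left-handed version `* = h_{Γ-}(-, Γ)` of the functor `RightComod.star`, from quasifinite
left comodules to right comodules. It is `RightComod.star` for the coopposite coalgebra, whose
right (left) comodules are the left (right) comodules over `Γ`. -/
def star : (IsQuasifinite (k := k) (Γ := Γ)).FullSubcategoryᵒᵖ ⥤ RightComod k Γ :=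
  (ObjectProperty.lift (RightComod.IsQuasifinite (k := k) (Γ := Cop Γ))
    ((IsQuasifinite (k := k) (Γ := Γ)).ι ⋙ Cop.toRight (Cop.isAntiIso_of (k := k) (Γ := Γ)))
    (fun M => Cop.isQuasifinite_toRight Cop.isAntiIso_of Cop.isAntiIso_of_symm M.obj
      M.property)).op ⋙
    RightComod.star ⋙ Cop.toRight (Cop.isAntiIso_of_symm (k := k) (Γ := Γ))

end LeftComod

/-- If `*` maps quasifinite injective right comodules to quasifinite injective left comodules,
this is the restriction of `*` to a contravariant functor between these categories. -/
def RightComod.starInjective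
    (h : ∀ M : (RightComod.IsQuasifiniteInjective (k := k) (Γ := Γ)).FullSubcategory,
      LeftComod.IsQuasifiniteInjective (RightComod.star.obj (.op ⟨M.obj, M.property.1⟩))) :
    (RightComod.IsQuasifiniteInjective (k := k) (Γ := Γ)).FullSubcategoryᵒᵖ ⥤
      (LeftComod.IsQuasifiniteInjective (k := k) (Γ := Γ)).FullSubcategory :=
  ObjectProperty.lift _
    ((ObjectProperty.ιOfLE (P := RightComod.IsQuasifiniteInjective (k := k) (Γ := Γ))
      (P' := RightComod.IsQuasifinite) (fun _ hM => hM.1)).op ⋙ RightComod.star)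
    (fun M => h M.unop)

/-- If `*` maps quasifinite injective left comodules to quasifinite injective right comodules,
this is the restriction of `*` to a contravariant functor between these categories. -/
def LeftComod.starInjective
    (h : ∀ M : (LeftComod.IsQuasifiniteInjective (k := k) (Γ := Γ)).FullSubcategory,
      RightComod.IsQuasifiniteInjective (LeftComod.star.obj (.op ⟨M.obj, M.property.1⟩))) :
    (LeftComod.IsQuasifiniteInjective (k := k) (Γ := Γ)).FullSubcategoryᵒᵖ ⥤
      (RightComod.IsQuasifiniteInjective (k := k) (Γ := Γ)).FullSubcategory :=
  ObjectProperty.lift _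
    ((ObjectProperty.ιOfLE (P := LeftComod.IsQuasifiniteInjective (k := k) (Γ := Γ))
      (P' := LeftComod.IsQuasifinite) (fun _ hM => hM.1)).op ⋙ LeftComod.star)
    (fun M => h M.unop)

section Hit

/-- The right hit action `c ↼ e = ∑ e(c₁) c₂` of a functional `e` on `c ∈ Γ`. -/
def rightHit (e : Γ →ₗ[k] k) : Γ →ₗ[k] Γ :=
  (TensorProduct.lid k Γ).toLinearMap ∘ₗ e.rTensor Γ ∘ₗ comul

/-- The left hit action `e ⇀ c = ∑ c₁ e(c₂)` of a functional `e` on `c ∈ Γ`. -/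
def leftHit (e : Γ →ₗ[k] k) : Γ →ₗ[k] Γ :=
  (TensorProduct.rid k Γ).toLinearMap ∘ₗ e.lTensor Γ ∘ₗ comul

theorem comul_rightHit (e : Γ →ₗ[k] k) :
    comul ∘ₗ rightHit e = (rightHit e).rTensor Γ ∘ₗ comul := by
  have e1 : comul ∘ₗ (TensorProduct.lid k Γ).toLinearMap ∘ₗ e.rTensor Γ =
      (TensorProduct.lid k (Γ ⊗[k] Γ)).toLinearMap ∘ₗ e.rTensor (Γ ⊗[k] Γ) ∘ₗ
        (comul (R := k) (A := Γ)).lTensor Γ := by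
    ext a b
    simp
  have e2 : (TensorProduct.lid k (Γ ⊗[k] Γ)).toLinearMap ∘ₗ e.rTensor (Γ ⊗[k] Γ) ∘ₗ
      (TensorProduct.assoc k Γ Γ Γ).toLinearMap =
      ((TensorProduct.lid k Γ).toLinearMap ∘ₗ e.rTensor Γ).rTensor Γ := by
    ext a b c
    simp [TensorProduct.smul_tmul']
  calc _ = (comul ∘ₗ (TensorProduct.lid k Γ).toLinearMap ∘ₗ e.rTensor Γ) ∘ₗ comul := rfl
    _ = ((TensorProduct.lid k (Γ ⊗[k] Γ)).toLinearMap ∘ₗ e.rTensor (Γ ⊗[k] Γ)) ∘ₗ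
        (comul (R := k) (A := Γ)).lTensor Γ ∘ₗ comul := by rw [e1]; rfl
    _ = ((TensorProduct.lid k (Γ ⊗[k] Γ)).toLinearMap ∘ₗ e.rTensor (Γ ⊗[k] Γ) ∘ₗ
      (TensorProduct.assoc k Γ Γ Γ).toLinearMap) ∘ₗ
        (comul (R := k) (A := Γ)).rTensor Γ ∘ₗ comul := by rw [← Coalgebra.coassoc]; rfl
    _ = _ := by rw [e2, ← LinearMap.comp_assoc, ← LinearMap.rTensor_comp]; rfl

theorem comul_leftHit (e : Γ →ₗ[k] k) :
    comul ∘ₗ leftHit e = (leftHit e).lTensor Γ ∘ₗ comul := by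
  have e1 : comul ∘ₗ (TensorProduct.rid k Γ).toLinearMap ∘ₗ e.lTensor Γ =
      (TensorProduct.rid k (Γ ⊗[k] Γ)).toLinearMap ∘ₗ e.lTensor (Γ ⊗[k] Γ) ∘ₗ
        (comul (R := k) (A := Γ)).rTensor Γ := by
    ext a b
    simp
  have e2 : (TensorProduct.rid k (Γ ⊗[k] Γ)).toLinearMap ∘ₗ e.lTensor (Γ ⊗[k] Γ) =
      ((TensorProduct.rid k Γ).toLinearMap ∘ₗ e.lTensor Γ).lTensor Γ ∘ₗ
        (TensorProduct.assoc k Γ Γ Γ).toLinearMap := by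
    ext a b c
    simp
  calc _ = (comul ∘ₗ (TensorProduct.rid k Γ).toLinearMap ∘ₗ e.lTensor Γ) ∘ₗ comul := rfl
    _ = ((TensorProduct.rid k (Γ ⊗[k] Γ)).toLinearMap ∘ₗ e.lTensor (Γ ⊗[k] Γ)) ∘ₗ
        (comul (R := k) (A := Γ)).rTensor Γ ∘ₗ comul := by rw [e1]; rfl
    _ = ((TensorProduct.rid k Γ).toLinearMap ∘ₗ e.lTensor Γ).lTensor Γ ∘ₗ
        (comul (R := k) (A := Γ)).lTensor Γ ∘ₗ comul := by rw [e2, ← Coalgebra.coassoc]; rfl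
    _ = _ := by rw [← LinearMap.comp_assoc, ← LinearMap.lTensor_comp]; rfl

theorem isSubcomodule_range_rightHit (e : Γ →ₗ[k] k) :
    (RightComod.regular k Γ).IsSubcomodule (LinearMap.range (rightHit e)) := by
  rintro _ ⟨c, rfl⟩
  refine ⟨(rightHit e).rangeRestrict.rTensor Γ (comul c), ?_⟩
  rw [← LinearMap.rTensor_comp_apply]
  exact (LinearMap.congr_fun (comul_rightHit e) c).symm

/-- The right comodule `Γ e = {c ↼ e : c ∈ Γ}`, a subcomodule of `Γ`. -/
def RightComod.hit (e : Γ →ₗ[k] k) : RightComod k Γ :=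
  (RightComod.regular k Γ).sub (LinearMap.range (rightHit e)) (isSubcomodule_range_rightHit e)

theorem lTensor_subtype_injective {N G : Type u} [AddCommGroup N] [Module k N] [AddCommGroup G]
    [Module k G] (p : Submodule k N) : Function.Injective (p.subtype.lTensor G) :=
  Module.Flat.lTensor_preserves_injective_linearMap _ p.injective_subtype

theorem comul_mem_range_leftHit (e : Γ →ₗ[k] k) (x : LinearMap.range (leftHit e)) :
    comul (R := k) x.1 ∈
      LinearMap.range ((LinearMap.range (leftHit e)).subtype.lTensor Γ) := by
  obtain ⟨_, c, rfl⟩ := x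
  refine ⟨(leftHit e).rangeRestrict.lTensor Γ (comul c), ?_⟩
  rw [← LinearMap.lTensor_comp_apply]
  exact (LinearMap.congr_fun (comul_leftHit e) c).symm

/-- The restriction of the comultiplication of `Γ` to a map `eΓ → Γ ⊗ eΓ`. -/
def leftHitCoact (e : Γ →ₗ[k] k) :
    LinearMap.range (leftHit e) →ₗ[k] Γ ⊗[k] LinearMap.range (leftHit e) :=
  (LinearEquiv.ofInjective ((LinearMap.range (leftHit e)).subtype.lTensor Γ)
    (lTensor_subtype_injective _)).symm.toLinearMap ∘ₗ
    (comul ∘ₗ (LinearMap.range (leftHit e)).subtype).codRestrict _ (comul_mem_range_leftHit e)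

theorem subtype_leftHitCoact (e : Γ →ₗ[k] k) :
    (LinearMap.range (leftHit e)).subtype.lTensor Γ ∘ₗ leftHitCoact e =
      comul ∘ₗ (LinearMap.range (leftHit e)).subtype := by
  ext x
  have := LinearEquiv.apply_symm_apply
    (LinearEquiv.ofInjective ((LinearMap.range (leftHit e)).subtype.lTensor Γ)
      (lTensor_subtype_injective _))
    ((comul ∘ₗ (LinearMap.range (leftHit e)).subtype).codRestrict _
      (comul_mem_range_leftHit e) x)
  exact congrArg Subtype.val this

/-- The left comodule `e Γ = {e ⇀ c : c ∈ Γ}`, a subcomodule of `Γ`. -/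
def LeftComod.hit (e : Γ →ₗ[k] k) : LeftComod k Γ where
  carrier := LinearMap.range (leftHit e)
  coact := leftHitCoact e
  coassoc := by
    have h := subtype_leftHitCoact e
    set p := LinearMap.range (leftHit e)
    set δ := leftHitCoact e
    have inj : Function.Injective ((p.subtype.lTensor Γ).lTensor Γ) :=
      Module.Flat.lTensor_preserves_injective_linearMap _ (lTensor_subtype_injective p)
    rw [← LinearMap.cancel_left inj]
    have e1 : (p.subtype.lTensor Γ).lTensor Γ ∘ₗ (TensorProduct.assoc k Γ Γ p).toLinearMap ∘ₗ
        (comul (R := k) (A := Γ)).rTensor p =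
        (TensorProduct.assoc k Γ Γ Γ).toLinearMap ∘ₗ (comul (R := k) (A := Γ)).rTensor Γ ∘ₗ
          p.subtype.lTensor Γ := by
      apply TensorProduct.ext'
      intro a x
      simp only [LinearMap.comp_apply, LinearEquiv.coe_coe, LinearMap.rTensor_tmul,
        LinearMap.lTensor_tmul]
      induction comul (R := k) a with
      | zero => simp
      | add x y hx hy => simp only [map_add, add_tmul, hx, hy]
      | tmul x y => simp
    calc _ = ((p.subtype.lTensor Γ).lTensor Γ ∘ₗ (TensorProduct.assoc k Γ Γ p).toLinearMap ∘ₗ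
        (comul (R := k) (A := Γ)).rTensor p) ∘ₗ δ := rfl
      _ = (TensorProduct.assoc k Γ Γ Γ).toLinearMap ∘ₗ (comul (R := k) (A := Γ)).rTensor Γ ∘ₗ
          (p.subtype.lTensor Γ ∘ₗ δ) := by rw [e1]; rfl
      _ = ((TensorProduct.assoc k Γ Γ Γ).toLinearMap ∘ₗ (comul (R := k) (A := Γ)).rTensor Γ ∘ₗ
          comul) ∘ₗ p.subtype := by rw [h]; rfl
      _ = (comul (R := k) (A := Γ)).lTensor Γ ∘ₗ (comul ∘ₗ p.subtype) := by
        rw [Coalgebra.coassoc]; rfl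
      _ = ((comul (R := k) (A := Γ)).lTensor Γ ∘ₗ p.subtype.lTensor Γ) ∘ₗ δ := by rw [← h]; rfl
      _ = _ := by rw [← LinearMap.lTensor_comp, ← h, LinearMap.lTensor_comp]; rfl
  counit_coact := by
    have h := subtype_leftHitCoact e
    set p := LinearMap.range (leftHit e)
    set δ := leftHitCoact e
    have inj : Function.Injective (p.subtype.lTensor k) := lTensor_subtype_injective p
    rw [← LinearMap.cancel_left inj]
    calc _ = (p.subtype.lTensor k ∘ₗ (counit (R := k) (A := Γ)).rTensor p) ∘ₗ δ := rfl
      _ = (counit (R := k) (A := Γ)).rTensor Γ ∘ₗ (p.subtype.lTensor Γ ∘ₗ δ) := by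
        rw [LinearMap.lTensor_comp_rTensor, ← LinearMap.rTensor_comp_lTensor]; rfl
      _ = ((counit (R := k) (A := Γ)).rTensor Γ ∘ₗ comul) ∘ₗ p.subtype := by rw [h]; rfl
      _ = _ := by
        rw [Coalgebra.rTensor_counit_comp_comul]
        ext x
        simp

end Hit

end Comodule
end

/-!
A duality between a right comodule `M` and a left comodule `J` consists of a bicomodule map
`θ : Γ → J ⊗ M` and a functional `ψ` on `M ⊗ J` that satisfy two triangle identities
(`IsDualPair`). This is an adjunction between `k` and `Γ` in the bicategory of coalgebras and bicomodules,
and it is symmetric in `M` and `J` once `Γ` is replaced by its opposite (`IsDualPair.op`). The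
theorem follows from three facts about it.

* If `M` is in a dual pair, then it is quasifinite and injective. The first triangle identity says
  that `M ⊗ Γ → M ⊗ J ⊗ M → M` is a colinear retraction of the coaction, so `M` is a summand of a
  cofree comodule; and it bounds the images of all comodule maps `F → M`, for `F`
  finite-dimensional, by one finite-dimensional subspace (`RightComod.injective_of_triangle`,
  `RightComod.isQuasifinite_of_triangle`).
* If `M` is quasifinite and injective, then `M` and `M^*` form a dual pair with respect to the
  canonical map `θ_M` (`RightComod.exists_isDualPair`). A colinear retraction `r : M ⊗ Γ → M` of
  the coaction gives comodule maps `r(m ⊗ -) : Γ → M`; by the universal property they have the form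
  `(ψ_m ⊗ 1) θ_M` with `ψ_m : M^* → k`. The second triangle identity holds after composition with
  `θ_M`, hence holds.
* If `M` and `J` form a dual pair, then `J` has the universal property of `M^*`
  (`rTensor_contractRight_comp`), so that `M^* ≅ J`
  (`RightComod.exists_linearEquiv_of_isDualPair`).

Consequently `M^*` is quasifinite injective and `M^{**} ≅ M`, naturally by the uniqueness in the
universal property. For an idempotent `e`, the comodules `Γe` and `eΓ` form a dual pair with
`θ(c) = ∑ (e ⇀ c₁) ⊗ (c₂ ↼ e)` and `ψ = ε ⊗ ε` (`isDualPair_hit`).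
-/

noncomputable section

namespace Comodule

/-! ### Dual pairs of comodules -/

section DualPair

variable {k C : Type u} [Field k] [AddCommGroup C] [Module k C] [Coalgebra k C]
  {M J h : Type u} [AddCommGroup M] [Module k M] [AddCommGroup J] [Module k J]
  [AddCommGroup h] [Module k h]

/-- The contraction `M ⊗ (J ⊗ N) → N` along `ψ : M ⊗ J → k`. -/
def contractLeft (ψ : M ⊗[k] J →ₗ[k] k) (N : Type u) [AddCommGroup N] [Module k N] :
    M ⊗[k] (J ⊗[k] N) →ₗ[k] N :=
  (TensorProduct.lid k N).toLinearMap ∘ₗ ψ.rTensor N ∘ₗ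
    (TensorProduct.assoc k M J N).symm.toLinearMap

@[simp] theorem contractLeft_tmul (ψ : M ⊗[k] J →ₗ[k] k) (m : M) (j : J) (n : h) :
    contractLeft ψ h (m ⊗ₜ (j ⊗ₜ n)) = ψ (m ⊗ₜ j) • n := by
  simp [contractLeft]

/-- The contraction `(N ⊗ M) ⊗ J → N` along `ψ : M ⊗ J → k`. -/
def contractRight (ψ : M ⊗[k] J →ₗ[k] k) (N : Type u) [AddCommGroup N] [Module k N] :
    (N ⊗[k] M) ⊗[k] J →ₗ[k] N :=
  (TensorProduct.rid k N).toLinearMap ∘ₗ ψ.lTensor N ∘ₗ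
    (TensorProduct.assoc k N M J).toLinearMap

@[simp] theorem contractRight_tmul (ψ : M ⊗[k] J →ₗ[k] k) (m : M) (j : J) (n : h) :
    contractRight ψ h ((n ⊗ₜ m) ⊗ₜ j) = ψ (m ⊗ₜ j) • n := by
  simp [contractRight]

/-- A duality between a right comodule `(M, ρ)` and a left comodule `(J, l)` over `C`: a bicomodule
map `θ : C → J ⊗ M` and a functional `ψ` on `M ⊗ J` that satisfy the two triangle identities. Only
the restriction of `ψ` to the cotensor product `M □ J` matters; taking `ψ` to be defined on all of
`M ⊗ J` avoids cotensor products. -/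
structure IsDualPair (ρ : M →ₗ[k] M ⊗[k] C) (l : J →ₗ[k] C ⊗[k] J) (θ : C →ₗ[k] J ⊗[k] M)
    (ψ : M ⊗[k] J →ₗ[k] k) : Prop where
  right_colinear : (TensorProduct.assoc k J M C).symm.toLinearMap ∘ₗ ρ.lTensor J ∘ₗ θ =
    θ.rTensor C ∘ₗ comul
  left_colinear : l.rTensor M ∘ₗ θ =
    (TensorProduct.assoc k C J M).symm.toLinearMap ∘ₗ θ.lTensor C ∘ₗ comul
  right_triangle : contractLeft ψ M ∘ₗ θ.lTensor M ∘ₗ ρ = LinearMap.id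
  left_triangle : contractRight ψ J ∘ₗ θ.rTensor J ∘ₗ l = LinearMap.id

/-- If the left colinear map `θ : C → J ⊗ M` satisfies the first triangle identity, then every
right comodule map `θ' : C → h ⊗ M` factors through `θ`, by means of the map
`J → C ⊗ J → h ⊗ M ⊗ J → h`. -/
theorem rTensor_contractRight_comp {ρ : M →ₗ[k] M ⊗[k] C} {l : J →ₗ[k] C ⊗[k] J}
    {θ : C →ₗ[k] J ⊗[k] M} {ψ : M ⊗[k] J →ₗ[k] k}
    (hl : l.rTensor M ∘ₗ θ =
      (TensorProduct.assoc k C J M).symm.toLinearMap ∘ₗ θ.lTensor C ∘ₗ comul)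
    (ht : contractLeft ψ M ∘ₗ θ.lTensor M ∘ₗ ρ = LinearMap.id)
    (θ' : C →ₗ[k] h ⊗[k] M)
    (hθ' : (TensorProduct.assoc k h M C).symm.toLinearMap ∘ₗ ρ.lTensor h ∘ₗ θ' =
      θ'.rTensor C ∘ₗ comul) :
    (contractRight ψ h ∘ₗ θ'.rTensor J ∘ₗ l).rTensor M ∘ₗ θ = θ' := by
  have e1 : (θ'.rTensor J).rTensor M ∘ₗ (TensorProduct.assoc k C J M).symm.toLinearMap =
      (TensorProduct.assoc k (h ⊗[k] M) J M).symm.toLinearMap ∘ₗ θ'.rTensor (J ⊗[k] M) := by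
    ext c j m
    simp
  have e2 : (contractRight ψ h).rTensor M ∘ₗ
      (TensorProduct.assoc k (h ⊗[k] M) J M).symm.toLinearMap ∘ₗ θ.lTensor (h ⊗[k] M) ∘ₗ
        (TensorProduct.assoc k h M C).symm.toLinearMap =
      (contractLeft ψ M ∘ₗ θ.lTensor M).lTensor h := by
    ext a m c
    simp only [AlgebraTensorModule.curry_apply, curry_apply, LinearMap.restrictScalars_apply,
      LinearMap.comp_apply, LinearEquiv.coe_coe, TensorProduct.assoc_symm_tmul,
      LinearMap.lTensor_tmul]
    induction θ c with
    | zero => simp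
    | add x y hx hy => simp only [map_add, tmul_add, hx, hy]
    | tmul x y => simp [TensorProduct.smul_tmul]
  calc _ = (contractRight ψ h).rTensor M ∘ₗ (θ'.rTensor J).rTensor M ∘ₗ (l.rTensor M ∘ₗ θ) := by
        simp only [LinearMap.rTensor_comp, LinearMap.comp_assoc]
    _ = (contractRight ψ h).rTensor M ∘ₗ ((θ'.rTensor J).rTensor M ∘ₗ
        (TensorProduct.assoc k C J M).symm.toLinearMap) ∘ₗ θ.lTensor C ∘ₗ comul := by rw [hl]; rfl
    _ = (contractRight ψ h).rTensor M ∘ₗ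
        (TensorProduct.assoc k (h ⊗[k] M) J M).symm.toLinearMap ∘ₗ
          (θ'.rTensor (J ⊗[k] M) ∘ₗ θ.lTensor C) ∘ₗ comul := by rw [e1]; rfl
    _ = (contractRight ψ h).rTensor M ∘ₗ
        (TensorProduct.assoc k (h ⊗[k] M) J M).symm.toLinearMap ∘ₗ
          θ.lTensor (h ⊗[k] M) ∘ₗ (θ'.rTensor C ∘ₗ comul) := by
        rw [LinearMap.rTensor_comp_lTensor, ← LinearMap.lTensor_comp_rTensor]; rfl
    _ = ((contractRight ψ h).rTensor M ∘ₗ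
      (TensorProduct.assoc k (h ⊗[k] M) J M).symm.toLinearMap ∘ₗ θ.lTensor (h ⊗[k] M) ∘ₗ
        (TensorProduct.assoc k h M C).symm.toLinearMap) ∘ₗ ρ.lTensor h ∘ₗ θ' := by
        rw [← hθ']; rfl
    _ = (contractLeft ψ M ∘ₗ θ.lTensor M ∘ₗ ρ).lTensor h ∘ₗ θ' := by
        rw [e2]; simp only [LinearMap.lTensor_comp, LinearMap.comp_assoc]
    _ = θ' := by rw [ht]; simp

/-- The map `N ⊗ C → N ⊗ J ⊗ M → M` given by `θ` and `ψ` is a comodule map on the cofree comodule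
`N ⊗ C`. -/
theorem contractLeft_colinear {ρ : M →ₗ[k] M ⊗[k] C} {θ : C →ₗ[k] J ⊗[k] M}
    (N : Type u) [AddCommGroup N] [Module k N] (ψ : N ⊗[k] J →ₗ[k] k)
    (hr : (TensorProduct.assoc k J M C).symm.toLinearMap ∘ₗ ρ.lTensor J ∘ₗ θ =
      θ.rTensor C ∘ₗ comul) :
    ρ ∘ₗ contractLeft ψ M ∘ₗ θ.lTensor N =
      (contractLeft ψ M ∘ₗ θ.lTensor N).rTensor C ∘ₗ
        (TensorProduct.assoc k N C C).symm.toLinearMap ∘ₗ (comul (R := k) (A := C)).lTensor N := by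
  have e1 : ρ ∘ₗ contractLeft ψ M =
      contractLeft ψ (M ⊗[k] C) ∘ₗ (ρ.lTensor J).lTensor N := by
    ext n j m
    simp
  have e2 : contractLeft ψ (M ⊗[k] C) ∘ₗ (TensorProduct.assoc k J M C).toLinearMap.lTensor N ∘ₗ
      (θ.rTensor C).lTensor N = (contractLeft ψ M ∘ₗ θ.lTensor N).rTensor C ∘ₗ
        (TensorProduct.assoc k N C C).symm.toLinearMap := by
    ext n c d
    simp only [AlgebraTensorModule.curry_apply, curry_apply, LinearMap.restrictScalars_apply,
      LinearMap.comp_apply, LinearEquiv.coe_coe, TensorProduct.assoc_symm_tmul,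
      LinearMap.lTensor_tmul, LinearMap.rTensor_tmul]
    induction θ c with
    | zero => simp
    | add x y hx hy => simp only [map_add, tmul_add, add_tmul, hx, hy]
    | tmul x y => simp [TensorProduct.smul_tmul']
  have e3 : ρ.lTensor J ∘ₗ θ =
      (TensorProduct.assoc k J M C).toLinearMap ∘ₗ θ.rTensor C ∘ₗ comul := by
    rw [← hr]
    ext c
    simp
  calc _ = (ρ ∘ₗ contractLeft ψ M) ∘ₗ θ.lTensor N := rfl
    _ = contractLeft ψ (M ⊗[k] C) ∘ₗ (ρ.lTensor J ∘ₗ θ).lTensor N := by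
      rw [e1, LinearMap.lTensor_comp]; rfl
    _ = (contractLeft ψ (M ⊗[k] C) ∘ₗ (TensorProduct.assoc k J M C).toLinearMap.lTensor N ∘ₗ
      (θ.rTensor C).lTensor N) ∘ₗ (comul (R := k) (A := C)).lTensor N := by
      rw [e3]; simp only [LinearMap.lTensor_comp, LinearMap.comp_assoc]
    _ = _ := by rw [e2]; rfl

end DualPair

/-! ### Injective and quasifinite comodules -/

section RightComodules

variable {k Γ : Type u} [Field k] [AddCommGroup Γ] [Module k Γ] [Coalgebra k Γ]

/-- The left contractions of a fixed tensor span a finite-dimensional space. -/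
theorem exists_finite_forall_slice_mem {V M : Type u} [AddCommGroup V] [Module k V]
    [AddCommGroup M] [Module k M] (t : V ⊗[k] M) :
    ∃ p : Submodule k M, Module.Finite k p ∧ ∀ φ : V →ₗ[k] k, slice M φ t ∈ p := by
  classical
  obtain ⟨S, hS⟩ := TensorProduct.exists_finset (R := k) t
  refine ⟨Submodule.span k (S.image Prod.snd : Finset M), inferInstance, fun φ => ?_⟩
  rw [hS, map_sum]
  refine Submodule.sum_mem _ fun i hi => ?_
  rw [slice_tmul]
  exact Submodule.smul_mem _ _ (Submodule.subset_span (Finset.mem_image_of_mem _ hi))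

namespace RightComod

/-- The kernel of a comodule map is a subcomodule. -/
theorem isSubcomodule_ker {M N : RightComod k Γ} (f : homs M N) :
    M.IsSubcomodule (LinearMap.ker f.1) := by
  intro x hx
  refine mem_range_rTensor_of_forall _ _ fun φ => ?_
  have h : ∀ t : M.carrier ⊗[k] Γ, f.1 (TensorProduct.rid k _ (φ.lTensor _ t)) =
      TensorProduct.rid k _ (φ.lTensor _ (f.1.rTensor Γ t)) := by
    intro t
    induction t with
    | zero => simp
    | add a b ha hb => simp only [map_add, ha, hb]
    | tmul a b => simp
  rw [LinearMap.mem_ker, h, ← homs_apply, LinearMap.mem_ker.1 hx]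
  simp

theorem injective_of_mono {M N : RightComod k Γ} (f : M ⟶ N) [hf : Mono f] :
    Function.Injective f.1 := by
  let p := LinearMap.ker f.1
  have hp : M.IsSubcomodule p := isSubcomodule_ker f
  let i : M.sub p hp ⟶ M := ⟨p.subtype, (M.subtype_subCoact p hp).symm⟩
  let z : M.sub p hp ⟶ M := ⟨0, Submodule.zero_mem _⟩
  have h : i ≫ f = z ≫ f := by
    refine Subtype.ext (LinearMap.ext fun x => ?_)
    have hx : f.1 x.1 = 0 := x.2
    change f.1 x.1 = f.1 0
    rw [hx, map_zero]
  have hiz : i = z := (cancel_mono f).1 h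
  rw [← LinearMap.ker_eq_bot, eq_bot_iff]
  intro x hx
  exact LinearMap.congr_fun (congrArg Subtype.val hiz) (⟨x, hx⟩ : p)

theorem mono_of_injective {M N : RightComod k Γ} (f : M ⟶ N) (hf : Function.Injective f.1) :
    Mono f where
  right_cancellation _ _ e :=
    Subtype.ext ((LinearMap.cancel_left hf).1 (congrArg Subtype.val e))

/-- The cofree right comodule `V ⊗ Γ` on a vector space `V`. -/
def cofree (V : Type u) [AddCommGroup V] [Module k V] : RightComod k Γ where
  carrier := V ⊗[k] Γ
  coact := (TensorProduct.assoc k V Γ Γ).symm.toLinearMap ∘ₗ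
    (comul (R := k) (A := Γ)).lTensor V
  coassoc := by
    have e1 : (TensorProduct.assoc k (V ⊗[k] Γ) Γ Γ).toLinearMap ∘ₗ
        ((TensorProduct.assoc k V Γ Γ).symm.toLinearMap ∘ₗ
          (comul (R := k) (A := Γ)).lTensor V).rTensor Γ ∘ₗ
        (TensorProduct.assoc k V Γ Γ).symm.toLinearMap =
        (TensorProduct.assoc k V Γ (Γ ⊗[k] Γ)).symm.toLinearMap ∘ₗ
          ((TensorProduct.assoc k Γ Γ Γ).toLinearMap ∘ₗ
            (comul (R := k) (A := Γ)).rTensor Γ).lTensor V := by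
      ext v a b
      simp only [AlgebraTensorModule.curry_apply, curry_apply, LinearMap.restrictScalars_apply,
        LinearMap.comp_apply, LinearEquiv.coe_coe, TensorProduct.assoc_symm_tmul,
        LinearMap.lTensor_tmul, LinearMap.rTensor_tmul]
      induction comul (R := k) a with
      | zero => simp
      | add x y hx hy => simp only [map_add, tmul_add, add_tmul, hx, hy]
      | tmul x y => simp
    have e2 : (comul (R := k) (A := Γ)).lTensor (V ⊗[k] Γ) ∘ₗ
        (TensorProduct.assoc k V Γ Γ).symm.toLinearMap =
        (TensorProduct.assoc k V Γ (Γ ⊗[k] Γ)).symm.toLinearMap ∘ₗ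
          ((comul (R := k) (A := Γ)).lTensor Γ).lTensor V := by
      ext v a b
      simp
    calc _ = ((TensorProduct.assoc k (V ⊗[k] Γ) Γ Γ).toLinearMap ∘ₗ
        ((TensorProduct.assoc k V Γ Γ).symm.toLinearMap ∘ₗ
          (comul (R := k) (A := Γ)).lTensor V).rTensor Γ ∘ₗ
        (TensorProduct.assoc k V Γ Γ).symm.toLinearMap) ∘ₗ
          (comul (R := k) (A := Γ)).lTensor V := rfl
      _ = (TensorProduct.assoc k V Γ (Γ ⊗[k] Γ)).symm.toLinearMap ∘ₗ
          ((TensorProduct.assoc k Γ Γ Γ).toLinearMap ∘ₗ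
            (comul (R := k) (A := Γ)).rTensor Γ ∘ₗ comul).lTensor V := by
        rw [e1]; simp only [LinearMap.lTensor_comp, LinearMap.comp_assoc]
      _ = ((TensorProduct.assoc k V Γ (Γ ⊗[k] Γ)).symm.toLinearMap ∘ₗ
          ((comul (R := k) (A := Γ)).lTensor Γ).lTensor V) ∘ₗ
            (comul (R := k) (A := Γ)).lTensor V := by
        rw [Coalgebra.coassoc, LinearMap.lTensor_comp]; rfl
      _ = _ := by rw [← e2]; rfl
  counit_coact := by
    have e : (counit (R := k) (A := Γ)).lTensor (V ⊗[k] Γ) ∘ₗ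
        (TensorProduct.assoc k V Γ Γ).symm.toLinearMap =
        (TensorProduct.assoc k V Γ k).symm.toLinearMap ∘ₗ
          ((counit (R := k) (A := Γ)).lTensor Γ).lTensor V := by
      ext v a b
      simp
    rw [← LinearMap.comp_assoc, e, LinearMap.comp_assoc, ← LinearMap.lTensor_comp,
      Coalgebra.lTensor_counit_comp_comul]
    ext v a
    simp

/-- A linear map `g : N → V` induces a comodule map `N → V ⊗ Γ`. -/
def toCofree (N : RightComod k Γ) {V : Type u} [AddCommGroup V] [Module k V]
    (g : N.carrier →ₗ[k] V) : N ⟶ cofree (Γ := Γ) V :=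
  ⟨g.rTensor Γ ∘ₗ N.coact, by
    have e : (comul (R := k) (A := Γ)).lTensor V ∘ₗ g.rTensor Γ =
        g.rTensor (Γ ⊗[k] Γ) ∘ₗ (comul (R := k) (A := Γ)).lTensor N.carrier := by
      rw [LinearMap.lTensor_comp_rTensor, LinearMap.rTensor_comp_lTensor]
    have e2 : (TensorProduct.assoc k V Γ Γ).symm.toLinearMap ∘ₗ g.rTensor (Γ ⊗[k] Γ) ∘ₗ
        (TensorProduct.assoc k N.carrier Γ Γ).toLinearMap = (g.rTensor Γ).rTensor Γ := by
      ext n a b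
      simp
    rw [mem_homs]
    calc _ = (TensorProduct.assoc k V Γ Γ).symm.toLinearMap ∘ₗ
          ((comul (R := k) (A := Γ)).lTensor V ∘ₗ g.rTensor Γ) ∘ₗ N.coact := rfl
      _ = (TensorProduct.assoc k V Γ Γ).symm.toLinearMap ∘ₗ g.rTensor (Γ ⊗[k] Γ) ∘ₗ
          ((comul (R := k) (A := Γ)).lTensor N.carrier ∘ₗ N.coact) := by rw [e]; rfl
      _ = ((TensorProduct.assoc k V Γ Γ).symm.toLinearMap ∘ₗ g.rTensor (Γ ⊗[k] Γ) ∘ₗ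
          (TensorProduct.assoc k N.carrier Γ Γ).toLinearMap) ∘ₗ N.coact.rTensor Γ ∘ₗ
            N.coact := by rw [← N.coassoc]; rfl
      _ = (g.rTensor Γ).rTensor Γ ∘ₗ N.coact.rTensor Γ ∘ₗ N.coact := by rw [e2]
      _ = (g.rTensor Γ ∘ₗ N.coact).rTensor Γ ∘ₗ N.coact := by
        rw [LinearMap.rTensor_comp]; rfl
      _ = _ := rfl⟩

theorem coact_injective (M : RightComod k Γ) : Function.Injective M.coact := by
  refine Function.LeftInverse.injective
    (g := TensorProduct.rid k M.carrier ∘ (counit (R := k) (A := Γ)).lTensor M.carrier)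
    fun x => ?_
  have := LinearMap.congr_fun M.counit_coact x
  rw [LinearMap.comp_apply] at this
  rw [Function.comp_apply, this]
  simp

/-- The coaction of an injective comodule is a split embedding into a cofree comodule. -/
theorem exists_retraction {M : RightComod k Γ} (hM : Injective M) :
    ∃ r : M.carrier ⊗[k] Γ →ₗ[k] M.carrier, r ∈ homs (cofree M.carrier) M ∧
      r ∘ₗ M.coact = LinearMap.id := by
  let i : M ⟶ cofree M.carrier := M.toCofree LinearMap.id
  have hi : ∀ x, i.1 x = M.coact x := fun x => by
    change (LinearMap.id.rTensor Γ ∘ₗ M.coact) x = _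
    rw [LinearMap.rTensor_id, LinearMap.id_comp]
  have hinj : Function.Injective i.1 := fun x y hxy =>
    M.coact_injective (by rw [← hi, ← hi, hxy])
  have := mono_of_injective i hinj
  refine ⟨(Injective.factorThru (𝟙 M) i).1, (Injective.factorThru (𝟙 M) i).2,
    LinearMap.ext fun x => ?_⟩
  have := LinearMap.congr_fun (congrArg Subtype.val (Injective.comp_factorThru (𝟙 M) i)) x
  change (Injective.factorThru (𝟙 M) i).1 (i.1 x) = x at this
  rwa [hi] at this

/-- A comodule whose coaction splits is injective. -/
theorem injective_of_retraction {M : RightComod k Γ} (r : M.carrier ⊗[k] Γ →ₗ[k] M.carrier)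
    (hr : r ∈ homs (cofree M.carrier) M) (hid : r ∘ₗ M.coact = LinearMap.id) : Injective M where
  factors {X Y} g f _ := by
    obtain ⟨q, hq⟩ := LinearMap.exists_leftInverse_of_injective f.1
      (LinearMap.ker_eq_bot.2 (injective_of_mono f))
    let r' : cofree M.carrier ⟶ M := ⟨r, hr⟩
    -- `g ∘ q` extends `g` linearly; the retraction makes it colinear.
    refine ⟨Y.toCofree (g.1 ∘ₗ q) ≫ r', Subtype.ext ?_⟩
    calc r ∘ₗ ((g.1 ∘ₗ q).rTensor Γ ∘ₗ Y.coact) ∘ₗ f.1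
        = r ∘ₗ (g.1 ∘ₗ q).rTensor Γ ∘ₗ (Y.coact ∘ₗ f.1) := rfl
      _ = r ∘ₗ ((g.1 ∘ₗ q) ∘ₗ f.1).rTensor Γ ∘ₗ X.coact := by
        rw [mem_homs.1 f.2, LinearMap.rTensor_comp _ _ f.1]; rfl
      _ = r ∘ₗ (M.coact ∘ₗ g.1) := by
        rw [LinearMap.comp_assoc, hq, LinearMap.comp_id, mem_homs.1 g.2]
      _ = g.1 := by rw [← LinearMap.comp_assoc, hid, LinearMap.id_comp]

/-! ### Quasifinite injective comodules and dual pairs -/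

variable {M : RightComod k Γ} {J : Type u} [AddCommGroup J] [Module k J]
  {θ : Γ →ₗ[k] J ⊗[k] M.carrier} {ψ : M.carrier ⊗[k] J →ₗ[k] k}

/-- The first triangle identity splits the coaction of `M`, so that `M` is injective. -/
theorem injective_of_triangle
    (hr : (TensorProduct.assoc k J M.carrier Γ).symm.toLinearMap ∘ₗ M.coact.lTensor J ∘ₗ θ =
      θ.rTensor Γ ∘ₗ comul)
    (ht : contractLeft ψ M.carrier ∘ₗ θ.lTensor M.carrier ∘ₗ M.coact = LinearMap.id) :
    Injective M :=
  injective_of_retraction (contractLeft ψ M.carrier ∘ₗ θ.lTensor M.carrier)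
    (contractLeft_colinear M.carrier ψ hr) ht

/-- The triangle identity bounds the images of all comodule maps from a finite-dimensional
comodule to `M` by a common finite-dimensional subspace of `M`. -/
theorem isQuasifinite_of_triangle
    (ht : contractLeft ψ M.carrier ∘ₗ θ.lTensor M.carrier ∘ₗ M.coact = LinearMap.id) :
    IsQuasifinite M := by
  intro F hF
  let b := Module.finBasis k F.carrier
  let t : F.carrier →ₗ[k] (F.carrier ⊗[k] J) ⊗[k] M.carrier :=
    (TensorProduct.assoc k F.carrier J M.carrier).symm.toLinearMap ∘ₗ
      θ.lTensor F.carrier ∘ₗ F.coact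
  have hf : ∀ (f : homs F M) (x : F.carrier),
      f.1 x = slice M.carrier (ψ ∘ₗ f.1.rTensor J) (t x) := by
    intro f x
    have e : contractLeft ψ M.carrier ∘ₗ f.1.rTensor (J ⊗[k] M.carrier) =
        slice M.carrier (ψ ∘ₗ f.1.rTensor J) ∘ₗ
          (TensorProduct.assoc k F.carrier J M.carrier).symm.toLinearMap := by
      ext a j m
      simp
    calc f.1 x = (contractLeft ψ M.carrier ∘ₗ θ.lTensor M.carrier ∘ₗ M.coact) (f.1 x) := by
          rw [ht]; rfl
      _ = contractLeft ψ M.carrier ((θ.lTensor M.carrier ∘ₗ f.1.rTensor Γ) (F.coact x)) := by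
          rw [LinearMap.comp_apply, LinearMap.comp_apply, homs_apply]; rfl
      _ = (contractLeft ψ M.carrier ∘ₗ f.1.rTensor (J ⊗[k] M.carrier))
          (θ.lTensor F.carrier (F.coact x)) := by
          rw [LinearMap.lTensor_comp_rTensor, ← LinearMap.rTensor_comp_lTensor]; rfl
      _ = _ := by rw [e]; rfl
  choose p hp hmem using fun i => exists_finite_forall_slice_mem (t (b i))
  let q : Submodule k M.carrier := ⨆ i, p i
  have hq : ∀ (f : homs F M) (x : F.carrier), f.1 x ∈ q := by
    intro f x
    rw [← b.sum_repr x, map_sum]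
    refine Submodule.sum_mem _ fun i _ => ?_
    rw [map_smul, hf]
    exact Submodule.smul_mem _ _ (Submodule.mem_iSup_of_mem i (hmem i _))
  let c : homs F M →ₗ[k] F.carrier →ₗ[k] q :=
    { toFun := fun f => f.1.codRestrict q (hq f)
      map_add' := fun _ _ => rfl
      map_smul' := fun _ _ => rfl }
  refine Module.Finite.of_injective c fun f g hfg => Subtype.ext (LinearMap.ext fun x => ?_)
  exact congrArg Subtype.val (LinearMap.congr_fun hfg x)

/-- A quasifinite injective comodule `M` is dual to `h_{-Γ}(M, Γ)`: a retraction `M ⊗ Γ → M` of the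
coaction yields, by the universal property of cohom, a functional on `M ⊗ h_{-Γ}(M, Γ)`. -/
theorem exists_isDualPair {M : RightComod k Γ} (hM : IsQuasifinite M) (hI : Injective M) :
    ∃ ψ, IsDualPair M.coact (Cohom.leftCoact hM) (Cohom.theta hM) ψ := by
  obtain ⟨r, hr, hid⟩ := exists_retraction hI
  have hu : ∀ m : M.carrier, ∃ u : Cohom M (regular k Γ) →ₗ[k] k, ∀ c,
      slice M.carrier u (Cohom.theta hM c) = r (m ⊗ₜ c) := by
    intro m
    obtain ⟨u, hu⟩ := Cohom.exists_lift hM (N := regular k Γ) (W := k)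
      (TensorProduct.mk k k M.carrier 1 ∘ₗ r ∘ₗ TensorProduct.mk k M.carrier Γ m) (by
        ext c
        have h1 := LinearMap.congr_fun (mem_homs.1 hr) (m ⊗ₜ c)
        have h2 : ∀ t : Γ ⊗[k] Γ, (TensorProduct.assoc k k M.carrier Γ).symm (1 ⊗ₜ[k]
            r.rTensor Γ ((TensorProduct.assoc k M.carrier Γ Γ).symm (m ⊗ₜ t))) =
            (TensorProduct.mk k k M.carrier 1 ∘ₗ r ∘ₗ
              TensorProduct.mk k M.carrier Γ m).rTensor Γ t := by
          intro t
          induction t with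
          | zero => simp
          | add x y hx hy => simp only [map_add, tmul_add, hx, hy]
          | tmul x y => simp
        refine Eq.trans ?_ (h2 (comul c))
        change (TensorProduct.assoc k k M.carrier Γ).symm (1 ⊗ₜ[k] M.coact (r (m ⊗ₜ c))) = _
        congr 2)
    refine ⟨u, fun c => ?_⟩
    refine (congrArg (TensorProduct.lid k M.carrier) (LinearMap.congr_fun hu c)).trans ?_
    change TensorProduct.lid k M.carrier (1 ⊗ₜ r (m ⊗ₜ c)) = _
    rw [TensorProduct.lid_tmul, one_smul]
  choose u hu using hu
  -- The functionals `u m` depend linearly on `m`, but fixing them on a basis is enough.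
  let b := Module.Basis.ofVectorSpace k M.carrier
  let ψ : M.carrier ⊗[k] Cohom M (regular k Γ) →ₗ[k] k :=
    TensorProduct.lift (b.constr k fun i => u (b i))
  have hψ : contractLeft ψ M.carrier ∘ₗ (Cohom.theta hM).lTensor M.carrier = r := by
    refine TensorProduct.ext (b.ext fun i => LinearMap.ext fun c => ?_)
    have h1 : ∀ t : Cohom M (regular k Γ) ⊗[k] M.carrier,
        contractLeft ψ M.carrier (b i ⊗ₜ t) = slice M.carrier (u (b i)) t := by
      intro t
      induction t with
      | zero => simp
      | add x y hx hy => simp only [map_add, tmul_add, hx, hy]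
      | tmul x y => simp [ψ]
    exact (h1 _).trans (hu _ c)
  have ht : contractLeft ψ M.carrier ∘ₗ (Cohom.theta hM).lTensor M.carrier ∘ₗ M.coact =
      LinearMap.id := by
    rw [← LinearMap.comp_assoc, hψ, hid]
  refine ⟨ψ, Cohom.coev_colinear hM (regular k Γ), Cohom.leftCoact_theta hM, ht, ?_⟩
  refine Cohom.theta_unique hM ?_
  rw [rTensor_contractRight_comp (Cohom.leftCoact_theta hM) ht (Cohom.theta hM)
    (Cohom.coev_colinear hM (regular k Γ))]
  simp

/-- If `M` is dual to the left comodule `J`, then the linear map `h_{-Γ}(M, Γ) → J` given by the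
universal property of cohom is an isomorphism of left comodules. -/
theorem exists_linearEquiv_of_isDualPair {M : RightComod k Γ} (hM : IsQuasifinite M)
    {l : J →ₗ[k] Γ ⊗[k] J} {θ : Γ →ₗ[k] J ⊗[k] M.carrier} {ψ : M.carrier ⊗[k] J →ₗ[k] k}
    (h : IsDualPair M.coact l θ ψ) :
    ∃ u : Cohom M (regular k Γ) ≃ₗ[k] J,
      u.toLinearMap.rTensor M.carrier ∘ₗ Cohom.theta hM = θ ∧
      l ∘ₗ u.toLinearMap = u.toLinearMap.lTensor Γ ∘ₗ Cohom.leftCoact hM := by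
  obtain ⟨u, hu⟩ := Cohom.exists_lift hM (N := regular k Γ) θ h.right_colinear
  change u.rTensor M.carrier ∘ₗ Cohom.theta hM = θ at hu
  let v : J →ₗ[k] Cohom M (regular k Γ) :=
    contractRight ψ _ ∘ₗ (Cohom.theta hM).rTensor J ∘ₗ l
  have hv : v.rTensor M.carrier ∘ₗ θ = Cohom.theta hM :=
    rTensor_contractRight_comp h.left_colinear h.right_triangle _
      (Cohom.coev_colinear hM (regular k Γ))
  have huv : u ∘ₗ v = LinearMap.id := by
    have e : u ∘ₗ contractRight ψ (Cohom M (regular k Γ)) =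
        contractRight ψ J ∘ₗ (u.rTensor M.carrier).rTensor J := by
      ext a m j
      simp
    rw [← h.left_triangle, ← hu, LinearMap.rTensor_comp]
    calc _ = (u ∘ₗ contractRight ψ (Cohom M (regular k Γ))) ∘ₗ
          (Cohom.theta hM).rTensor J ∘ₗ l := rfl
      _ = _ := by rw [e]; rfl
  have hvu : v ∘ₗ u = LinearMap.id := by
    refine Cohom.theta_unique hM ?_
    rw [LinearMap.rTensor_comp, LinearMap.comp_assoc, hu, hv]
    simp
  refine ⟨LinearEquiv.ofLinearMap u v huv hvu, hu, ?_⟩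
  refine Cohom.theta_unique hM (mapAux LinearMap.id u _ _ _ _ h.left_colinear
    (Cohom.leftCoact_theta hM) ?_)
  rw [hu]
  simp

end RightComod

end RightComodules

section Iso

variable {k Γ : Type u} [Field k] [AddCommGroup Γ] [Module k Γ] [Coalgebra k Γ]

/-- A bijective map of right comodules is an isomorphism. -/
def RightComod.isoOfLinearEquiv {M N : RightComod k Γ} (e : M.carrier ≃ₗ[k] N.carrier)
    (h : N.coact ∘ₗ e.toLinearMap = e.toLinearMap.rTensor Γ ∘ₗ M.coact) : M ≅ N where
  hom := ⟨e.toLinearMap, h⟩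
  inv := ⟨e.symm.toLinearMap, by
    rw [RightComod.mem_homs, ← LinearMap.cancel_right e.surjective, LinearMap.comp_assoc,
      LinearMap.comp_assoc, h, ← LinearMap.comp_assoc (M.coact), ← LinearMap.rTensor_comp]
    simp⟩
  hom_inv_id := Subtype.ext (LinearMap.ext e.symm_apply_apply)
  inv_hom_id := Subtype.ext (LinearMap.ext e.apply_symm_apply)

/-- A bijective map of left comodules is an isomorphism. -/
def LeftComod.isoOfLinearEquiv {M N : LeftComod k Γ} (e : M.carrier ≃ₗ[k] N.carrier)
    (h : N.coact ∘ₗ e.toLinearMap = e.toLinearMap.lTensor Γ ∘ₗ M.coact) : M ≅ N where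
  hom := ⟨e.toLinearMap, h⟩
  inv := ⟨e.symm.toLinearMap, by
    rw [LeftComod.mem_homs, ← LinearMap.cancel_right e.surjective, LinearMap.comp_assoc,
      LinearMap.comp_assoc, h, ← LinearMap.comp_assoc (M.coact), ← LinearMap.lTensor_comp]
    simp⟩
  hom_inv_id := Subtype.ext (LinearMap.ext e.symm_apply_apply)
  inv_hom_id := Subtype.ext (LinearMap.ext e.apply_symm_apply)

end Iso

/-! ### Passage to the opposite coalgebra -/

section Transport

variable {k A B : Type u} [Field k] [AddCommGroup A] [Module k A] [Coalgebra k A]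
  [AddCommGroup B] [Module k B] [Coalgebra k B] {f : A ≃ₗ[k] B}

namespace Cop

theorem coact_toLeftObj_toRightObj (hf : IsAntiIso f) (hf' : IsAntiIso f.symm)
    (M : LeftComod k A) : (toLeftObj hf' (toRightObj hf M)).coact = M.coact := by
  have e : (f.symm.toLinearMap.rTensor M.carrier ∘ₗ
      (TensorProduct.comm k M.carrier B).toLinearMap) ∘ₗ f.toLinearMap.lTensor M.carrier ∘ₗ
        (TensorProduct.comm k A M.carrier).toLinearMap = LinearMap.id := by
    ext a m
    simp
  change ((f.symm.toLinearMap.rTensor M.carrier ∘ₗ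
      (TensorProduct.comm k M.carrier B).toLinearMap) ∘ₗ f.toLinearMap.lTensor M.carrier ∘ₗ
        (TensorProduct.comm k A M.carrier).toLinearMap) ∘ₗ M.coact = M.coact
  rw [e, LinearMap.id_comp]

theorem coact_toRightObj_toLeftObj (hf : IsAntiIso f) (hf' : IsAntiIso f.symm)
    (M : RightComod k A) : (toRightObj hf' (toLeftObj hf M)).coact = M.coact := by
  have e : (f.symm.toLinearMap.lTensor M.carrier ∘ₗ
      (TensorProduct.comm k B M.carrier).toLinearMap) ∘ₗ f.toLinearMap.rTensor M.carrier ∘ₗ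
        (TensorProduct.comm k M.carrier A).toLinearMap = LinearMap.id := by
    ext m a
    simp
  change ((f.symm.toLinearMap.lTensor M.carrier ∘ₗ
      (TensorProduct.comm k B M.carrier).toLinearMap) ∘ₗ f.toLinearMap.rTensor M.carrier ∘ₗ
        (TensorProduct.comm k M.carrier A).toLinearMap) ∘ₗ M.coact = M.coact
  rw [e, LinearMap.id_comp]

theorem toLeft_mem {M N : RightComod k A} (hf : IsAntiIso f) (g : RightComod.homs M N) :
    (show M.carrier →ₗ[k] N.carrier from g.1) ∈
      LeftComod.homs (toLeftObj hf M) (toLeftObj hf N) := by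
  change (f.toLinearMap.rTensor N.carrier ∘ₗ (TensorProduct.comm k N.carrier A).toLinearMap ∘ₗ
    N.coact) ∘ₗ g.1 = g.1.lTensor B ∘ₗ f.toLinearMap.rTensor M.carrier ∘ₗ
      (TensorProduct.comm k M.carrier A).toLinearMap ∘ₗ M.coact
  have e : g.1.lTensor B ∘ₗ f.toLinearMap.rTensor M.carrier ∘ₗ
      (TensorProduct.comm k M.carrier A).toLinearMap = f.toLinearMap.rTensor N.carrier ∘ₗ
        (TensorProduct.comm k N.carrier A).toLinearMap ∘ₗ g.1.rTensor A := by
    ext m a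
    simp
  calc _ = f.toLinearMap.rTensor N.carrier ∘ₗ (TensorProduct.comm k N.carrier A).toLinearMap ∘ₗ
        (N.coact ∘ₗ g.1) := rfl
    _ = (f.toLinearMap.rTensor N.carrier ∘ₗ
        (TensorProduct.comm k N.carrier A).toLinearMap ∘ₗ g.1.rTensor A) ∘ₗ M.coact := by
      rw [RightComod.mem_homs.1 g.2]; rfl
    _ = _ := by rw [← e]; rfl

/-- A map that is colinear for the opposite right comodules is a map of left comodules. -/
theorem mem_of_toRight_mem (hf : IsAntiIso f) (hf' : IsAntiIso f.symm) {M N : LeftComod k A}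
    (g : RightComod.homs (toRightObj hf M) (toRightObj hf N)) :
    (show M.carrier →ₗ[k] N.carrier from g.1) ∈ LeftComod.homs M N := by
  have h := LeftComod.mem_homs.1 (toLeft_mem hf' g)
  rwa [coact_toLeftObj_toRightObj, coact_toLeftObj_toRightObj] at h

theorem isEquivalence_toRight (hf : IsAntiIso f) (hf' : IsAntiIso f.symm) :
    (toRight (k := k) hf).IsEquivalence where
  faithful := ⟨fun h => by
    have := congrArg Subtype.val h
    exact Subtype.ext this⟩
  full := ⟨fun g => ⟨⟨g.1, mem_of_toRight_mem hf hf' g⟩, rfl⟩⟩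
  essSurj := ⟨fun N => ⟨toLeftObj hf' N, ⟨RightComod.isoOfLinearEquiv
    (M := toRightObj hf (toLeftObj hf' N)) (LinearEquiv.refl k N.carrier) (by
      change N.coact = (LinearMap.id : N.carrier →ₗ[k] N.carrier).rTensor B ∘ₗ
        (toRightObj hf (toLeftObj hf' N)).coact
      rw [LinearMap.rTensor_id]
      exact (coact_toRightObj_toLeftObj hf' hf N).symm)⟩⟩⟩

theorem isQuasifiniteInjective_toRight_iff (hf : IsAntiIso f) (hf' : IsAntiIso f.symm)
    (M : LeftComod k A) : RightComod.IsQuasifiniteInjective (toRightObj hf M) ↔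
      LeftComod.IsQuasifiniteInjective M := by
  have := isEquivalence_toRight (k := k) hf hf'
  refine and_congr ⟨fun h F hF => ?_, isQuasifinite_toRight hf hf' M⟩
    ((toRight hf).asEquivalence.map_injective_iff M)
  have := h (toRightObj hf F) hF
  let i : LeftComod.homs F M →ₗ[k] RightComod.homs (toRightObj hf F) (toRightObj hf M) :=
    { toFun := fun g => ⟨g.1, toRight_mem hf g⟩
      map_add' := fun _ _ => rfl
      map_smul' := fun _ _ => rfl }
  refine Module.Finite.of_injective i fun a b hab => ?_
  have := congrArg Subtype.val hab
  exact Subtype.ext this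

end Cop

/-- Duality between comodules is symmetric under passage to the opposite coalgebra. The coactions
are those of `Cop.toRightObj` and `Cop.toLeftObj`. -/
theorem IsDualPair.op (hf : Cop.IsAntiIso f) {M J : Type u} [AddCommGroup M] [Module k M]
    [AddCommGroup J] [Module k J] {ρ : M →ₗ[k] M ⊗[k] A} {l : J →ₗ[k] A ⊗[k] J}
    {θ : A →ₗ[k] J ⊗[k] M} {ψ : M ⊗[k] J →ₗ[k] k} (h : IsDualPair ρ l θ ψ) :
    IsDualPair (f.toLinearMap.lTensor J ∘ₗ (TensorProduct.comm k A J).toLinearMap ∘ₗ l)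
      (f.toLinearMap.rTensor M ∘ₗ (TensorProduct.comm k M A).toLinearMap ∘ₗ ρ)
      ((TensorProduct.comm k J M).toLinearMap ∘ₗ θ ∘ₗ f.symm.toLinearMap)
      (ψ ∘ₗ (TensorProduct.comm k J M).toLinearMap) where
  right_colinear := by
    -- the reversal `(a ⊗ j) ⊗ m ↦ (m ⊗ j) ⊗ f a`
    let σ : (A ⊗[k] J) ⊗[k] M →ₗ[k] (M ⊗[k] J) ⊗[k] B :=
      (TensorProduct.comm k B (M ⊗[k] J)).toLinearMap ∘ₗ
        TensorProduct.map f.toLinearMap (TensorProduct.comm k J M).toLinearMap ∘ₗ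
          (TensorProduct.assoc k A J M).toLinearMap
    have e1 : (TensorProduct.assoc k M J B).symm.toLinearMap ∘ₗ
        (f.toLinearMap.lTensor J ∘ₗ (TensorProduct.comm k A J).toLinearMap ∘ₗ l).lTensor M ∘ₗ
          (TensorProduct.comm k J M).toLinearMap = σ ∘ₗ l.rTensor M := by
      ext j m
      simp only [σ, AlgebraTensorModule.curry_apply, curry_apply, LinearMap.restrictScalars_apply,
        LinearMap.comp_apply, LinearEquiv.coe_coe, TensorProduct.comm_tmul,
        LinearMap.lTensor_tmul, LinearMap.rTensor_tmul]
      induction l j with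
      | zero => simp
      | add x y hx hy => simp only [map_add, tmul_add, add_tmul, hx, hy]
      | tmul x y => simp
    have e2 : σ ∘ₗ (TensorProduct.assoc k A J M).symm.toLinearMap ∘ₗ θ.lTensor A =
        ((TensorProduct.comm k J M).toLinearMap ∘ₗ θ ∘ₗ f.symm.toLinearMap).rTensor B ∘ₗ
          TensorProduct.map f.toLinearMap f.toLinearMap ∘ₗ
            (TensorProduct.comm k A A).toLinearMap := by
      ext a b
      simp [σ]
    rw [← LinearMap.cancel_right f.surjective]
    calc _ = ((TensorProduct.assoc k M J B).symm.toLinearMap ∘ₗ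
        (f.toLinearMap.lTensor J ∘ₗ (TensorProduct.comm k A J).toLinearMap ∘ₗ l).lTensor M ∘ₗ
          (TensorProduct.comm k J M).toLinearMap) ∘ₗ θ ∘ₗ
            (f.symm.toLinearMap ∘ₗ f.toLinearMap) := rfl
      _ = σ ∘ₗ (l.rTensor M ∘ₗ θ) := by
        rw [e1, LinearEquiv.symm_comp, LinearMap.comp_id]; rfl
      _ = (σ ∘ₗ (TensorProduct.assoc k A J M).symm.toLinearMap ∘ₗ θ.lTensor A) ∘ₗ comul := by
        rw [h.left_colinear]; rfl
      _ = ((TensorProduct.comm k J M).toLinearMap ∘ₗ θ ∘ₗ f.symm.toLinearMap).rTensor B ∘ₗ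
          (TensorProduct.map f.toLinearMap f.toLinearMap ∘ₗ
            (TensorProduct.comm k A A).toLinearMap ∘ₗ comul) := by rw [e2]; rfl
      _ = _ := by rw [← hf.comul]; rfl
  left_colinear := by
    -- the reversal `j ⊗ (m ⊗ a) ↦ (f a ⊗ m) ⊗ j`
    let σ : (J ⊗[k] M) ⊗[k] A →ₗ[k] (B ⊗[k] M) ⊗[k] J :=
      (TensorProduct.assoc k B M J).symm.toLinearMap ∘ₗ
        TensorProduct.map f.toLinearMap (TensorProduct.comm k J M).toLinearMap ∘ₗ
          (TensorProduct.comm k (J ⊗[k] M) A).toLinearMap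
    have e1 : (f.toLinearMap.rTensor M ∘ₗ (TensorProduct.comm k M A).toLinearMap ∘ₗ
        ρ).rTensor J ∘ₗ (TensorProduct.comm k J M).toLinearMap =
          σ ∘ₗ (TensorProduct.assoc k J M A).symm.toLinearMap ∘ₗ ρ.lTensor J := by
      ext j m
      simp only [σ, AlgebraTensorModule.curry_apply, curry_apply, LinearMap.restrictScalars_apply,
        LinearMap.comp_apply, LinearEquiv.coe_coe, TensorProduct.comm_tmul,
        LinearMap.lTensor_tmul, LinearMap.rTensor_tmul]
      induction ρ m with
      | zero => simp
      | add x y hx hy => simp only [map_add, tmul_add, add_tmul, hx, hy]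
      | tmul x y => simp
    have e2 : σ ∘ₗ θ.rTensor A = (TensorProduct.assoc k B M J).symm.toLinearMap ∘ₗ
        ((TensorProduct.comm k J M).toLinearMap ∘ₗ θ ∘ₗ f.symm.toLinearMap).lTensor B ∘ₗ
          TensorProduct.map f.toLinearMap f.toLinearMap ∘ₗ
            (TensorProduct.comm k A A).toLinearMap := by
      ext a b
      simp [σ]
    rw [← LinearMap.cancel_right f.surjective]
    calc _ = ((f.toLinearMap.rTensor M ∘ₗ (TensorProduct.comm k M A).toLinearMap ∘ₗ
        ρ).rTensor J ∘ₗ (TensorProduct.comm k J M).toLinearMap) ∘ₗ θ ∘ₗ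
            (f.symm.toLinearMap ∘ₗ f.toLinearMap) := rfl
      _ = σ ∘ₗ ((TensorProduct.assoc k J M A).symm.toLinearMap ∘ₗ ρ.lTensor J ∘ₗ θ) := by
        rw [e1, LinearEquiv.symm_comp, LinearMap.comp_id]; rfl
      _ = (σ ∘ₗ θ.rTensor A) ∘ₗ comul := by rw [h.right_colinear]; rfl
      _ = (TensorProduct.assoc k B M J).symm.toLinearMap ∘ₗ
        ((TensorProduct.comm k J M).toLinearMap ∘ₗ θ ∘ₗ f.symm.toLinearMap).lTensor B ∘ₗ
          (TensorProduct.map f.toLinearMap f.toLinearMap ∘ₗ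
            (TensorProduct.comm k A A).toLinearMap ∘ₗ comul) := by rw [e2]; rfl
      _ = _ := by rw [← hf.comul]; rfl
  right_triangle := by
    have e : contractLeft (ψ ∘ₗ (TensorProduct.comm k J M).toLinearMap) J ∘ₗ
        ((TensorProduct.comm k J M).toLinearMap ∘ₗ θ ∘ₗ f.symm.toLinearMap).lTensor J ∘ₗ
          f.toLinearMap.lTensor J ∘ₗ (TensorProduct.comm k A J).toLinearMap =
        contractRight ψ J ∘ₗ θ.rTensor J := by
      ext a j
      simp only [AlgebraTensorModule.curry_apply, curry_apply, LinearMap.restrictScalars_apply,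
        LinearMap.comp_apply, LinearEquiv.coe_coe, TensorProduct.comm_tmul,
        LinearMap.lTensor_tmul, LinearMap.rTensor_tmul, LinearEquiv.symm_apply_apply]
      induction θ a with
      | zero => simp
      | add x y hx hy => simp only [map_add, tmul_add, add_tmul, hx, hy]
      | tmul x y => simp
    exact (congrArg (· ∘ₗ l) e).trans h.left_triangle
  left_triangle := by
    have e : contractRight (ψ ∘ₗ (TensorProduct.comm k J M).toLinearMap) M ∘ₗ
        ((TensorProduct.comm k J M).toLinearMap ∘ₗ θ ∘ₗ f.symm.toLinearMap).rTensor M ∘ₗ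
          f.toLinearMap.rTensor M ∘ₗ (TensorProduct.comm k M A).toLinearMap =
        contractLeft ψ M ∘ₗ θ.lTensor M := by
      ext m a
      simp only [AlgebraTensorModule.curry_apply, curry_apply, LinearMap.restrictScalars_apply,
        LinearMap.comp_apply, LinearEquiv.coe_coe, TensorProduct.comm_tmul,
        LinearMap.lTensor_tmul, LinearMap.rTensor_tmul, LinearEquiv.symm_apply_apply]
      induction θ a with
      | zero => simp
      | add x y hx hy => simp only [map_add, tmul_add, add_tmul, hx, hy]
      | tmul x y => simp
    exact (congrArg (· ∘ₗ ρ) e).trans h.right_triangle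

end Transport

/-! ### The bidual -/

section Bidual

variable {k A B : Type u} [Field k] [AddCommGroup A] [Module k A] [Coalgebra k A]
  [AddCommGroup B] [Module k B] [Coalgebra k B] {f : A ≃ₗ[k] B}

namespace RightComod

/-- The comodule `M^* = h_{-A}(M, A)` as a right comodule over the opposite coalgebra `B`. -/
abbrev opStar (hf : Cop.IsAntiIso f) {M : RightComod k A} (hM : IsQuasifinite M) :
    RightComod k B :=
  Cop.toRightObj hf (star.obj (.op ⟨M, hM⟩))

theorem isQuasifiniteInjective_opStar (hf : Cop.IsAntiIso f) {M : RightComod k A}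
    (hM : IsQuasifiniteInjective M) : IsQuasifiniteInjective (opStar hf hM.1) := by
  obtain ⟨ψ, h⟩ := exists_isDualPair hM.1 hM.2
  have h' := h.op hf
  exact ⟨isQuasifinite_of_triangle (M := opStar hf hM.1) h'.right_triangle,
    injective_of_triangle (M := opStar hf hM.1) h'.right_colinear h'.right_triangle⟩

/-- `M^*` and `M` form a dual pair over the opposite coalgebra, which identifies the dual of `M^*`
with `M`. -/
theorem exists_bidualEquiv (hf : Cop.IsAntiIso f) {M : RightComod k A}
    (hM : IsQuasifiniteInjective M) :
    ∃ u : Cohom (opStar hf hM.1) (regular k B) ≃ₗ[k] M.carrier,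
      u.toLinearMap.rTensor (Cohom M (regular k A)) ∘ₗ
        Cohom.theta (isQuasifiniteInjective_opStar hf hM).1 =
          (TensorProduct.comm k _ _).toLinearMap ∘ₗ Cohom.theta hM.1 ∘ₗ f.symm.toLinearMap ∧
      (Cop.toLeftObj hf M).coact ∘ₗ u.toLinearMap =
        u.toLinearMap.lTensor B ∘ₗ Cohom.leftCoact (isQuasifiniteInjective_opStar hf hM).1 := by
  obtain ⟨ψ, h⟩ := exists_isDualPair hM.1 hM.2
  exact exists_linearEquiv_of_isDualPair (M := opStar hf hM.1)
    (isQuasifiniteInjective_opStar hf hM).1 (h.op hf)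

/-- The isomorphism `M^{**} ≅ M` for `M` quasifinite injective. It is determined by the property
that it turns the canonical map of `M^*` into that of `M`, with the tensor factors exchanged. -/
def bidualEquiv (hf : Cop.IsAntiIso f) {M : RightComod k A} (hM : IsQuasifiniteInjective M) :
    Cohom (opStar hf hM.1) (regular k B) ≃ₗ[k] M.carrier :=
  (exists_bidualEquiv hf hM).choose

theorem bidualEquiv_theta (hf : Cop.IsAntiIso f) {M : RightComod k A}
    (hM : IsQuasifiniteInjective M) :
    (bidualEquiv hf hM).toLinearMap.rTensor (Cohom M (regular k A)) ∘ₗ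
      Cohom.theta (isQuasifiniteInjective_opStar hf hM).1 =
        (TensorProduct.comm k _ _).toLinearMap ∘ₗ Cohom.theta hM.1 ∘ₗ f.symm.toLinearMap :=
  (exists_bidualEquiv hf hM).choose_spec.1

theorem bidualEquiv_colinear (hf : Cop.IsAntiIso f) {M : RightComod k A}
    (hM : IsQuasifiniteInjective M) :
    (Cop.toLeftObj hf M).coact ∘ₗ (bidualEquiv hf hM).toLinearMap =
      (bidualEquiv hf hM).toLinearMap.lTensor B ∘ₗ
        Cohom.leftCoact (isQuasifiniteInjective_opStar hf hM).1 :=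
  (exists_bidualEquiv hf hM).choose_spec.2

/-- The contravariant action of a comodule map `g : M → N` on the comodules `M^*` and `N^*`. -/
def opStarMap (hf : Cop.IsAntiIso f) {M N : RightComod k A} (hM : IsQuasifinite M)
    (hN : IsQuasifinite N) (g : homs M N) : homs (opStar hf hN) (opStar hf hM) :=
  ⟨Cohom.map g (regular k A), Cop.toRight_mem hf
    (M := star.obj (.op ⟨N, hN⟩)) (N := star.obj (.op ⟨M, hM⟩))
    ⟨Cohom.map g (regular k A), Cohom.leftCoact_map hM hN g⟩⟩

/-- Naturality of `M^{**} ≅ M`: both sides agree after composition with the canonical map of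
`M^*`. -/
theorem bidualEquiv_natural (hf : Cop.IsAntiIso f) {M N : RightComod k A}
    (hM : IsQuasifiniteInjective M) (hN : IsQuasifiniteInjective N) (g : homs M N) :
    (bidualEquiv hf hN).toLinearMap ∘ₗ
      Cohom.map (opStarMap hf hM.1 hN.1 g) (regular k B) =
        g.1 ∘ₗ (bidualEquiv hf hM).toLinearMap := by
  refine Cohom.theta_unique (isQuasifiniteInjective_opStar hf hM).1 ?_
  have h1 : (Cohom.map (opStarMap hf hM.1 hN.1 g) (regular k B)).rTensor
      (Cohom M (regular k A)) ∘ₗ Cohom.theta (isQuasifiniteInjective_opStar hf hM).1 =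
        (Cohom.map g (regular k A)).lTensor _ ∘ₗ
          Cohom.theta (isQuasifiniteInjective_opStar hf hN).1 :=
    Cohom.map_coev (isQuasifiniteInjective_opStar hf hN).1
      (isQuasifiniteInjective_opStar hf hM).1 (opStarMap hf hM.1 hN.1 g) (regular k B)
  have h2 : (Cohom.map g (regular k A)).rTensor N.carrier ∘ₗ Cohom.theta hN.1 =
      g.1.lTensor _ ∘ₗ Cohom.theta hM.1 := Cohom.map_coev hM.1 hN.1 g (regular k A)
  change _ = (g.1 ∘ₗ (bidualEquiv hf hM).toLinearMap).rTensor (Cohom M (regular k A)) ∘ₗ _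
  calc (((bidualEquiv hf hN).toLinearMap ∘ₗ Cohom.map (opStarMap hf hM.1 hN.1 g)
        (regular k B)).rTensor (Cohom M (regular k A))) ∘ₗ
          Cohom.theta (isQuasifiniteInjective_opStar hf hM).1
      = (bidualEquiv hf hN).toLinearMap.rTensor (Cohom M (regular k A)) ∘ₗ
        (Cohom.map (opStarMap hf hM.1 hN.1 g) (regular k B)).rTensor (Cohom M (regular k A)) ∘ₗ
          Cohom.theta (isQuasifiniteInjective_opStar hf hM).1 := by
        rw [LinearMap.rTensor_comp]; rfl
    _ = ((bidualEquiv hf hN).toLinearMap.rTensor (Cohom M (regular k A)) ∘ₗ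
        (Cohom.map g (regular k A)).lTensor _) ∘ₗ
          Cohom.theta (isQuasifiniteInjective_opStar hf hN).1 := by rw [h1]; rfl
    _ = (Cohom.map g (regular k A)).lTensor _ ∘ₗ
        ((bidualEquiv hf hN).toLinearMap.rTensor (Cohom N (regular k A)) ∘ₗ
          Cohom.theta (isQuasifiniteInjective_opStar hf hN).1) := by
        rw [LinearMap.rTensor_comp_lTensor, ← LinearMap.lTensor_comp_rTensor]; rfl
    _ = ((Cohom.map g (regular k A)).lTensor N.carrier ∘ₗ
        (TensorProduct.comm k _ N.carrier).toLinearMap) ∘ₗ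
          Cohom.theta hN.1 ∘ₗ f.symm.toLinearMap := by rw [bidualEquiv_theta]; rfl
    _ = (TensorProduct.comm k _ N.carrier).toLinearMap ∘ₗ
        ((Cohom.map g (regular k A)).rTensor N.carrier ∘ₗ Cohom.theta hN.1) ∘ₗ
          f.symm.toLinearMap := by
        have e : (Cohom.map g (regular k A)).lTensor N.carrier ∘ₗ
            (TensorProduct.comm k _ N.carrier).toLinearMap =
            (TensorProduct.comm k _ N.carrier).toLinearMap ∘ₗ
              (Cohom.map g (regular k A)).rTensor N.carrier := by
          ext a b
          simp
        rw [e]; rfl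
    _ = ((TensorProduct.comm k _ N.carrier).toLinearMap ∘ₗ g.1.lTensor _) ∘ₗ
        Cohom.theta hM.1 ∘ₗ f.symm.toLinearMap := by rw [h2]; rfl
    _ = g.1.rTensor _ ∘ₗ ((TensorProduct.comm k _ M.carrier).toLinearMap ∘ₗ
        Cohom.theta hM.1 ∘ₗ f.symm.toLinearMap) := by
        have e : (TensorProduct.comm k (Cohom M (regular k A)) N.carrier).toLinearMap ∘ₗ
            g.1.lTensor _ = g.1.rTensor _ ∘ₗ (TensorProduct.comm k _ M.carrier).toLinearMap := by
          ext a b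
          simp
        rw [e]; rfl
    _ = _ := by rw [← bidualEquiv_theta, LinearMap.rTensor_comp]; rfl

end RightComod

end Bidual

/-! ### The duality between right and left comodules -/

section Duality

variable {k Γ : Type u} [Field k] [AddCommGroup Γ] [Module k Γ] [Coalgebra k Γ]

theorem RightComod.isQuasifiniteInjective_star {M : RightComod k Γ}
    (hM : IsQuasifiniteInjective M) :
    LeftComod.IsQuasifiniteInjective (star.obj (.op ⟨M, hM.1⟩)) :=
  (Cop.isQuasifiniteInjective_toRight_iff Cop.isAntiIso_of Cop.isAntiIso_of_symm _).1
    (isQuasifiniteInjective_opStar Cop.isAntiIso_of hM)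

theorem LeftComod.isQuasifiniteInjective_toRightObj {M : LeftComod k Γ}
    (hM : IsQuasifiniteInjective M) :
    RightComod.IsQuasifiniteInjective
      (Cop.toRightObj (Cop.isAntiIso_of (k := k) (Γ := Γ)) M) :=
  (Cop.isQuasifiniteInjective_toRight_iff Cop.isAntiIso_of Cop.isAntiIso_of_symm M).2 hM

theorem LeftComod.isQuasifiniteInjective_star {M : LeftComod k Γ}
    (hM : IsQuasifiniteInjective M) :
    RightComod.IsQuasifiniteInjective (star.obj (.op ⟨M, hM.1⟩)) :=
  RightComod.isQuasifiniteInjective_opStar Cop.isAntiIso_of_symm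
    (isQuasifiniteInjective_toRightObj hM)

/-- The isomorphism `M^{**} ≅ M` for a quasifinite injective right comodule `M`. -/
def RightComod.starStarIso {M : RightComod k Γ} (hM : IsQuasifiniteInjective M) :
    LeftComod.star.obj (.op ⟨star.obj (.op ⟨M, hM.1⟩), (isQuasifiniteInjective_star hM).1⟩) ≅ M :=
  isoOfLinearEquiv (bidualEquiv Cop.isAntiIso_of hM) (by
    let X := star.obj (.op ⟨opStar Cop.isAntiIso_of hM.1,
      (isQuasifiniteInjective_opStar Cop.isAntiIso_of hM).1⟩)
    have h := mem_homs.1 (Cop.toRight_mem Cop.isAntiIso_of_symm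
      (M := X) (N := Cop.toLeftObj Cop.isAntiIso_of M)
      ⟨(bidualEquiv Cop.isAntiIso_of hM).toLinearMap, bidualEquiv_colinear Cop.isAntiIso_of hM⟩)
    rw [Cop.coact_toRightObj_toLeftObj] at h
    exact h)

/-- The isomorphism `M^{**} ≅ M` for a quasifinite injective left comodule `M`. -/
def LeftComod.starStarIso {M : LeftComod k Γ} (hM : IsQuasifiniteInjective M) :
    RightComod.star.obj
      (.op ⟨star.obj (.op ⟨M, hM.1⟩), (isQuasifiniteInjective_star hM).1⟩) ≅ M :=
  isoOfLinearEquiv (RightComod.bidualEquiv Cop.isAntiIso_of_symm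
      (isQuasifiniteInjective_toRightObj hM)) (by
    have h := RightComod.bidualEquiv_colinear Cop.isAntiIso_of_symm
      (isQuasifiniteInjective_toRightObj hM)
    have e := Cop.coact_toLeftObj_toRightObj Cop.isAntiIso_of Cop.isAntiIso_of_symm M
    rw [e] at h
    exact h)

/-- The isomorphisms `M^{**} ≅ M` for right comodules are natural. -/
def RightComod.starStarNatIso
    (hR : ∀ M : (RightComod.IsQuasifiniteInjective (k := k) (Γ := Γ)).FullSubcategory,
      LeftComod.IsQuasifiniteInjective (RightComod.star.obj (.op ⟨M.obj, M.property.1⟩)))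
    (hL : ∀ M : (LeftComod.IsQuasifiniteInjective (k := k) (Γ := Γ)).FullSubcategory,
      RightComod.IsQuasifiniteInjective (LeftComod.star.obj (.op ⟨M.obj, M.property.1⟩))) :
    (RightComod.starInjective hR).rightOp ⋙ LeftComod.starInjective hL ≅
      𝟭 (RightComod.IsQuasifiniteInjective (k := k) (Γ := Γ)).FullSubcategory :=
  NatIso.ofComponents (fun M => ObjectProperty.isoMk _ (starStarIso M.property))
    fun {M N} g => ObjectProperty.hom_ext _
      (Subtype.ext (bidualEquiv_natural Cop.isAntiIso_of M.property N.property g.hom))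

/-- The isomorphisms `M^{**} ≅ M` for left comodules are natural. -/
def LeftComod.starStarNatIso
    (hR : ∀ M : (RightComod.IsQuasifiniteInjective (k := k) (Γ := Γ)).FullSubcategory,
      LeftComod.IsQuasifiniteInjective (RightComod.star.obj (.op ⟨M.obj, M.property.1⟩)))
    (hL : ∀ M : (LeftComod.IsQuasifiniteInjective (k := k) (Γ := Γ)).FullSubcategory,
      RightComod.IsQuasifiniteInjective (LeftComod.star.obj (.op ⟨M.obj, M.property.1⟩))) :
    (LeftComod.starInjective hL).rightOp ⋙ RightComod.starInjective hR ≅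
      𝟭 (LeftComod.IsQuasifiniteInjective (k := k) (Γ := Γ)).FullSubcategory :=
  NatIso.ofComponents (fun M => ObjectProperty.isoMk _ (starStarIso M.property))
    fun {M N} g => ObjectProperty.hom_ext _
      (Subtype.ext (RightComod.bidualEquiv_natural Cop.isAntiIso_of_symm
        (isQuasifiniteInjective_toRightObj M.property)
        (isQuasifiniteInjective_toRightObj N.property)
        ⟨g.hom.1, Cop.toRight_mem Cop.isAntiIso_of g.hom⟩))

/-- Contravariant functors that are mutually quasi-inverse are equivalences. -/
theorem isEquivalence_of_rightOp_comp_iso {C D : Type*} [Category C] [Category D]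
    (F : Cᵒᵖ ⥤ D) (G : Dᵒᵖ ⥤ C) (α : F.rightOp ⋙ G ≅ 𝟭 C) (β : G.rightOp ⋙ F ≅ 𝟭 D) :
    F.IsEquivalence :=
  (CategoryTheory.Equivalence.mk F G.rightOp (NatIso.op α) β).isEquivalence_functor

end Duality

/-! ### Comodules given by idempotents of the dual algebra -/

section Idempotent

variable {k Γ : Type u} [Field k] [AddCommGroup Γ] [Module k Γ] [Coalgebra k Γ]

theorem counit_comp_leftHit (e : Γ →ₗ[k] k) : counit ∘ₗ leftHit e = e := by
  have h : counit ∘ₗ (TensorProduct.rid k Γ).toLinearMap ∘ₗ e.lTensor Γ =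
      (TensorProduct.lid k k).toLinearMap ∘ₗ e.lTensor k ∘ₗ
        (counit (R := k) (A := Γ)).rTensor Γ := by
    ext a b
    simp [mul_comm]
  calc _ = (counit ∘ₗ (TensorProduct.rid k Γ).toLinearMap ∘ₗ e.lTensor Γ) ∘ₗ comul := rfl
    _ = (TensorProduct.lid k k).toLinearMap ∘ₗ e.lTensor k ∘ₗ
        ((counit (R := k) (A := Γ)).rTensor Γ ∘ₗ comul) := by rw [h]; rfl
    _ = e := by
      rw [Coalgebra.rTensor_counit_comp_comul]
      ext a
      simp

theorem counit_comp_rightHit (e : Γ →ₗ[k] k) : counit ∘ₗ rightHit e = e := by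
  have h : counit ∘ₗ (TensorProduct.lid k Γ).toLinearMap ∘ₗ e.rTensor Γ =
      (TensorProduct.rid k k).toLinearMap ∘ₗ e.rTensor k ∘ₗ
        (counit (R := k) (A := Γ)).lTensor Γ := by
    ext a b
    simp [mul_comm]
  calc _ = (counit ∘ₗ (TensorProduct.lid k Γ).toLinearMap ∘ₗ e.rTensor Γ) ∘ₗ comul := rfl
    _ = (TensorProduct.rid k k).toLinearMap ∘ₗ e.rTensor k ∘ₗ
        ((counit (R := k) (A := Γ)).lTensor Γ ∘ₗ comul) := by rw [h]; rfl
    _ = e := by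
      rw [Coalgebra.lTensor_counit_comp_comul]
      ext a
      simp

theorem comp_rightHit_eq_of_isIdempotentElem {e : Γ →ₗ[k] k}
    (he : IsIdempotentElem (WithConv.toConv e)) : e ∘ₗ rightHit e = e := by
  have h := congrArg WithConv.ofConv he.eq
  rw [LinearMap.convMul_def] at h
  refine Eq.trans ?_ h
  have : e ∘ₗ (TensorProduct.lid k Γ).toLinearMap ∘ₗ e.rTensor Γ =
      LinearMap.mul' k k ∘ₗ TensorProduct.map e e := by
    ext a b
    simp
  exact congrArg (· ∘ₗ comul) this

theorem comp_leftHit_eq_of_isIdempotentElem {e : Γ →ₗ[k] k}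
    (he : IsIdempotentElem (WithConv.toConv e)) : e ∘ₗ leftHit e = e := by
  have h := congrArg WithConv.ofConv he.eq
  rw [LinearMap.convMul_def] at h
  refine Eq.trans ?_ h
  have : e ∘ₗ (TensorProduct.rid k Γ).toLinearMap ∘ₗ e.lTensor Γ =
      LinearMap.mul' k k ∘ₗ TensorProduct.map e e := by
    ext a b
    simp [mul_comm]
  exact congrArg (· ∘ₗ comul) this

theorem rightHit_comp_rightHit {e : Γ →ₗ[k] k} (he : IsIdempotentElem (WithConv.toConv e)) :
    rightHit e ∘ₗ rightHit e = rightHit e := by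
  calc _ = (TensorProduct.lid k Γ).toLinearMap ∘ₗ e.rTensor Γ ∘ₗ (comul ∘ₗ rightHit e) := rfl
    _ = (TensorProduct.lid k Γ).toLinearMap ∘ₗ (e ∘ₗ rightHit e).rTensor Γ ∘ₗ comul := by
      rw [comul_rightHit, LinearMap.rTensor_comp]; rfl
    _ = _ := by rw [comp_rightHit_eq_of_isIdempotentElem he]; rfl

theorem leftHit_comp_leftHit {e : Γ →ₗ[k] k} (he : IsIdempotentElem (WithConv.toConv e)) :
    leftHit e ∘ₗ leftHit e = leftHit e := by
  calc _ = (TensorProduct.rid k Γ).toLinearMap ∘ₗ e.lTensor Γ ∘ₗ (comul ∘ₗ leftHit e) := rfl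
    _ = (TensorProduct.rid k Γ).toLinearMap ∘ₗ (e ∘ₗ leftHit e).lTensor Γ ∘ₗ comul := by
      rw [comul_leftHit, LinearMap.lTensor_comp]; rfl
    _ = _ := by rw [comp_leftHit_eq_of_isIdempotentElem he]; rfl

/-- The canonical bicomodule map `Γ → eΓ ⊗ Γe`, `c ↦ ∑ (e ⇀ c₁) ⊗ (c₂ ↼ e)`. -/
def hitTheta (e : Γ →ₗ[k] k) :
    Γ →ₗ[k] LinearMap.range (leftHit e) ⊗[k] LinearMap.range (rightHit e) :=
  TensorProduct.map (leftHit e).rangeRestrict (rightHit e).rangeRestrict ∘ₗ comul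

/-- The functional `x ⊗ y ↦ ε(x) ε(y)` on `Γe ⊗ eΓ`. -/
def hitPairing (e : Γ →ₗ[k] k) :
    LinearMap.range (rightHit e) ⊗[k] LinearMap.range (leftHit e) →ₗ[k] k :=
  LinearMap.mul' k k ∘ₗ TensorProduct.map (counit ∘ₗ Submodule.subtype _)
    (counit ∘ₗ Submodule.subtype _)

theorem subCoact_comp_rangeRestrict_rightHit (e : Γ →ₗ[k] k) :
    (RightComod.regular k Γ).subCoact _ (isSubcomodule_range_rightHit e) ∘ₗ
      (rightHit e).rangeRestrict = (rightHit e).rangeRestrict.rTensor Γ ∘ₗ comul := by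
  rw [← LinearMap.cancel_left (RightComod.rTensor_subtype_injective (G := Γ)
    (LinearMap.range (rightHit e)))]
  calc _ = ((LinearMap.range (rightHit e)).subtype.rTensor Γ ∘ₗ
        (RightComod.regular k Γ).subCoact _ (isSubcomodule_range_rightHit e)) ∘ₗ
          (rightHit e).rangeRestrict := rfl
    _ = comul ∘ₗ rightHit e := congrArg (· ∘ₗ (rightHit e).rangeRestrict)
        ((RightComod.regular k Γ).subtype_subCoact _ (isSubcomodule_range_rightHit e))
    _ = _ := by rw [comul_rightHit, ← LinearMap.comp_assoc, ← LinearMap.rTensor_comp]; rfl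

theorem leftHitCoact_comp_rangeRestrict (e : Γ →ₗ[k] k) :
    leftHitCoact e ∘ₗ (leftHit e).rangeRestrict =
      (leftHit e).rangeRestrict.lTensor Γ ∘ₗ comul := by
  rw [← LinearMap.cancel_left (lTensor_subtype_injective (G := Γ) (LinearMap.range (leftHit e)))]
  calc _ = ((LinearMap.range (leftHit e)).subtype.lTensor Γ ∘ₗ leftHitCoact e) ∘ₗ
        (leftHit e).rangeRestrict := rfl
    _ = comul ∘ₗ leftHit e := by rw [subtype_leftHitCoact]; rfl
    _ = _ := by rw [comul_leftHit, ← LinearMap.comp_assoc, ← LinearMap.lTensor_comp]; rfl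

theorem rangeRestrict_rightHit_comp {e : Γ →ₗ[k] k}
    (he : IsIdempotentElem (WithConv.toConv e)) :
    (rightHit e).rangeRestrict ∘ₗ rightHit e = (rightHit e).rangeRestrict :=
  LinearMap.ext fun c => Subtype.ext (LinearMap.congr_fun (rightHit_comp_rightHit he) c)

theorem rangeRestrict_leftHit_comp {e : Γ →ₗ[k] k}
    (he : IsIdempotentElem (WithConv.toConv e)) :
    (leftHit e).rangeRestrict ∘ₗ leftHit e = (leftHit e).rangeRestrict :=
  LinearMap.ext fun c => Subtype.ext (LinearMap.congr_fun (leftHit_comp_leftHit he) c)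

@[simp] theorem hitPairing_rangeRestrict_tmul (e : Γ →ₗ[k] k) (a b : Γ) :
    hitPairing e ((rightHit e).rangeRestrict a ⊗ₜ (leftHit e).rangeRestrict b) = e a * e b := by
  have h1 := LinearMap.congr_fun (counit_comp_rightHit e) a
  have h2 := LinearMap.congr_fun (counit_comp_leftHit e) b
  exact congrArg₂ (· * ·) h1 h2

/-- For an idempotent `e`, the comodules `Γe` and `eΓ` are dual to each other. -/
theorem isDualPair_hit {e : Γ →ₗ[k] k} (he : IsIdempotentElem (WithConv.toConv e)) :
    IsDualPair (M := LinearMap.range (rightHit e)) (J := LinearMap.range (leftHit e))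
      (RightComod.hit e).coact (leftHitCoact e) (hitTheta e) (hitPairing e) := by
  have hρ : _ ∘ₗ (rightHit e).rangeRestrict = _ := subCoact_comp_rangeRestrict_rightHit e
  have hl := leftHitCoact_comp_rangeRestrict e
  have hR := rangeRestrict_rightHit_comp he
  have hL := rangeRestrict_leftHit_comp he
  have hψ := hitPairing_rangeRestrict_tmul e
  have sR : Function.Surjective (rightHit e).rangeRestrict := LinearMap.surjective_rangeRestrict _
  have sL : Function.Surjective (leftHit e).rangeRestrict := LinearMap.surjective_rangeRestrict _
  let P := LinearMap.range (rightHit e)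
  let Q := LinearMap.range (leftHit e)
  let ρ : P →ₗ[k] P ⊗[k] Γ := (RightComod.hit e).coact
  change ρ ∘ₗ _ = _ at hρ
  change IsDualPair (M := P) (J := Q) ρ _ _ _
  unfold hitTheta
  generalize (rightHit e).rangeRestrict = R at *
  generalize (leftHit e).rangeRestrict = L at *
  have hcs : (TensorProduct.assoc k Γ Γ Γ).symm.toLinearMap ∘ₗ
      (comul (R := k) (A := Γ)).lTensor Γ ∘ₗ comul =
        (comul (R := k) (A := Γ)).rTensor Γ ∘ₗ comul := by
    rw [← Coalgebra.coassoc]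
    ext c
    simp
  refine ⟨?_, ?_, ?_, ?_⟩
  · have e1 : ρ.lTensor Q ∘ₗ TensorProduct.map L R =
        TensorProduct.map L (R.rTensor Γ) ∘ₗ (comul (R := k) (A := Γ)).lTensor Γ := by
      rw [LinearMap.lTensor_comp_map, hρ, LinearMap.map_comp_lTensor]
    have e2 : (TensorProduct.assoc k Q P Γ).symm.toLinearMap ∘ₗ
        TensorProduct.map L (R.rTensor Γ) = (TensorProduct.map L R).rTensor Γ ∘ₗ
          (TensorProduct.assoc k Γ Γ Γ).symm.toLinearMap := by
      ext a b c
      simp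
    calc _ = (TensorProduct.assoc k Q P Γ).symm.toLinearMap ∘ₗ
          (ρ.lTensor Q ∘ₗ TensorProduct.map L R) ∘ₗ comul := rfl
      _ = ((TensorProduct.assoc k Q P Γ).symm.toLinearMap ∘ₗ
        TensorProduct.map L (R.rTensor Γ)) ∘ₗ
          (comul (R := k) (A := Γ)).lTensor Γ ∘ₗ comul := by rw [e1]; rfl
      _ = (TensorProduct.map L R).rTensor Γ ∘ₗ
          ((TensorProduct.assoc k Γ Γ Γ).symm.toLinearMap ∘ₗ
            (comul (R := k) (A := Γ)).lTensor Γ ∘ₗ comul) := by rw [e2]; rfl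
      _ = _ := by rw [hcs, LinearMap.rTensor_comp]; rfl
  · have e1 : (leftHitCoact e).rTensor P ∘ₗ TensorProduct.map L R =
        TensorProduct.map (L.lTensor Γ) R ∘ₗ (comul (R := k) (A := Γ)).rTensor Γ := by
      rw [LinearMap.rTensor_comp_map, hl, LinearMap.map_comp_rTensor]
    have e2 : TensorProduct.map (L.lTensor Γ) R ∘ₗ
          (TensorProduct.assoc k Γ Γ Γ).symm.toLinearMap =
        (TensorProduct.assoc k Γ Q P).symm.toLinearMap ∘ₗ
          (TensorProduct.map L R).lTensor Γ := by
      ext a b c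
      simp
    calc _ = ((leftHitCoact e).rTensor P ∘ₗ TensorProduct.map L R) ∘ₗ comul := rfl
      _ = TensorProduct.map (L.lTensor Γ) R ∘ₗ
          ((comul (R := k) (A := Γ)).rTensor Γ ∘ₗ comul) := by rw [e1]; rfl
      _ = (TensorProduct.map (L.lTensor Γ) R ∘ₗ
          (TensorProduct.assoc k Γ Γ Γ).symm.toLinearMap) ∘ₗ
            (comul (R := k) (A := Γ)).lTensor Γ ∘ₗ comul := by rw [← hcs]; rfl
      _ = _ := by rw [e2, LinearMap.lTensor_comp]; rfl
  · have e1 : contractLeft (hitPairing e) P ∘ₗ (TensorProduct.map L R).lTensor P ∘ₗ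
        R.rTensor (Γ ⊗[k] Γ) = R ∘ₗ (TensorProduct.lid k Γ).toLinearMap ∘ₗ e.rTensor Γ ∘ₗ
          ((TensorProduct.lid k Γ).toLinearMap ∘ₗ e.rTensor Γ).lTensor Γ := by
      ext a b c
      simp [hψ, mul_comm (e a), mul_smul]
    have e2 : (TensorProduct.lid k Γ).toLinearMap ∘ₗ e.rTensor Γ ∘ₗ (rightHit e).lTensor Γ =
        rightHit e ∘ₗ (TensorProduct.lid k Γ).toLinearMap ∘ₗ e.rTensor Γ := by
      ext a b
      simp
    have e3 : (comul (R := k) (A := Γ)).lTensor P ∘ₗ R.rTensor Γ =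
        R.rTensor (Γ ⊗[k] Γ) ∘ₗ (comul (R := k) (A := Γ)).lTensor Γ := by
      rw [LinearMap.lTensor_comp_rTensor, ← LinearMap.rTensor_comp_lTensor]
    rw [← LinearMap.cancel_right sR]
    calc _ = contractLeft (hitPairing e) P ∘ₗ (TensorProduct.map L R ∘ₗ comul).lTensor P ∘ₗ
          (ρ ∘ₗ R) := rfl
      _ = contractLeft (hitPairing e) P ∘ₗ (TensorProduct.map L R).lTensor P ∘ₗ
          ((comul (R := k) (A := Γ)).lTensor P ∘ₗ R.rTensor Γ) ∘ₗ comul := by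
        rw [hρ, LinearMap.lTensor_comp]; rfl
      _ = (contractLeft (hitPairing e) P ∘ₗ (TensorProduct.map L R).lTensor P ∘ₗ
          R.rTensor (Γ ⊗[k] Γ)) ∘ₗ (comul (R := k) (A := Γ)).lTensor Γ ∘ₗ comul := by
        rw [e3]; rfl
      _ = R ∘ₗ ((TensorProduct.lid k Γ).toLinearMap ∘ₗ e.rTensor Γ ∘ₗ
          (rightHit e).lTensor Γ) ∘ₗ comul := by
        rw [e1]
        simp only [rightHit, LinearMap.lTensor_comp, LinearMap.comp_assoc]
        rfl
      _ = (R ∘ₗ rightHit e) ∘ₗ rightHit e := by rw [e2]; rfl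
      _ = _ := by rw [hR, hR, LinearMap.id_comp]
  · have e1 : contractRight (hitPairing e) Q ∘ₗ (TensorProduct.map L R).rTensor Q ∘ₗ
        L.lTensor (Γ ⊗[k] Γ) = L ∘ₗ (TensorProduct.rid k Γ).toLinearMap ∘ₗ e.lTensor Γ ∘ₗ
          ((TensorProduct.rid k Γ).toLinearMap ∘ₗ e.lTensor Γ).rTensor Γ := by
      ext a b c
      simp [hψ, mul_smul, smul_comm (e b)]
    have e2 : (TensorProduct.rid k Γ).toLinearMap ∘ₗ e.lTensor Γ ∘ₗ (leftHit e).rTensor Γ =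
        leftHit e ∘ₗ (TensorProduct.rid k Γ).toLinearMap ∘ₗ e.lTensor Γ := by
      ext a b
      simp
    have e3 : (comul (R := k) (A := Γ)).rTensor Q ∘ₗ L.lTensor Γ =
        L.lTensor (Γ ⊗[k] Γ) ∘ₗ (comul (R := k) (A := Γ)).rTensor Γ := by
      rw [LinearMap.rTensor_comp_lTensor, ← LinearMap.lTensor_comp_rTensor]
    rw [← LinearMap.cancel_right sL]
    calc _ = contractRight (hitPairing e) Q ∘ₗ (TensorProduct.map L R ∘ₗ comul).rTensor Q ∘ₗ
          (leftHitCoact e ∘ₗ L) := rfl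
      _ = contractRight (hitPairing e) Q ∘ₗ (TensorProduct.map L R).rTensor Q ∘ₗ
          ((comul (R := k) (A := Γ)).rTensor Q ∘ₗ L.lTensor Γ) ∘ₗ comul := by
        rw [hl, LinearMap.rTensor_comp]; rfl
      _ = (contractRight (hitPairing e) Q ∘ₗ (TensorProduct.map L R).rTensor Q ∘ₗ
          L.lTensor (Γ ⊗[k] Γ)) ∘ₗ (comul (R := k) (A := Γ)).rTensor Γ ∘ₗ comul := by
        rw [e3]; rfl
      _ = L ∘ₗ ((TensorProduct.rid k Γ).toLinearMap ∘ₗ e.lTensor Γ ∘ₗ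
          (leftHit e).rTensor Γ) ∘ₗ comul := by
        rw [e1]
        simp only [leftHit, LinearMap.rTensor_comp, LinearMap.comp_assoc]
        rfl
      _ = (L ∘ₗ leftHit e) ∘ₗ leftHit e := by rw [e2]; rfl
      _ = _ := by rw [hL, hL, LinearMap.id_comp]

end Idempotent

end Comodule

end

open CategoryTheory Comodule in
theorem theorem1 (k Γ : Type u) [Field k] [AddCommGroup Γ] [Module k Γ] [Coalgebra k Γ] :
    (∃ (hR : ∀ M : (RightComod.IsQuasifiniteInjective (k := k) (Γ := Γ)).FullSubcategory,
          LeftComod.IsQuasifiniteInjective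
            (RightComod.star.obj (Opposite.op ⟨M.obj, M.property.1⟩)))
        (hL : ∀ M : (LeftComod.IsQuasifiniteInjective (k := k) (Γ := Γ)).FullSubcategory,
          RightComod.IsQuasifiniteInjective
            (LeftComod.star.obj (Opposite.op ⟨M.obj, M.property.1⟩))),
      (RightComod.starInjective hR).IsEquivalence ∧
      (LeftComod.starInjective hL).IsEquivalence ∧
      Nonempty ((RightComod.starInjective hR).rightOp ⋙ LeftComod.starInjective hL ≅
        𝟭 (RightComod.IsQuasifiniteInjective (k := k) (Γ := Γ)).FullSubcategory) ∧
      Nonempty ((LeftComod.starInjective hL).rightOp ⋙ RightComod.starInjective hR ≅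
        𝟭 (LeftComod.IsQuasifiniteInjective (k := k) (Γ := Γ)).FullSubcategory)) ∧
    ∀ e : Γ →ₗ[k] k, IsIdempotentElem (WithConv.toConv e) →
      ∃ hq : RightComod.IsQuasifiniteInjective (RightComod.hit e),
        Nonempty (RightComod.star.obj (Opposite.op ⟨RightComod.hit e, hq.1⟩) ≅
          LeftComod.hit e) := by
  refine ⟨?_, fun e he => ?_⟩
  · have hR : ∀ M : (RightComod.IsQuasifiniteInjective (k := k) (Γ := Γ)).FullSubcategory,
        LeftComod.IsQuasifiniteInjective
          (RightComod.star.obj (Opposite.op ⟨M.obj, M.property.1⟩)) :=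
      fun M => RightComod.isQuasifiniteInjective_star M.property
    have hL : ∀ M : (LeftComod.IsQuasifiniteInjective (k := k) (Γ := Γ)).FullSubcategory,
        RightComod.IsQuasifiniteInjective
          (LeftComod.star.obj (Opposite.op ⟨M.obj, M.property.1⟩)) :=
      fun M => LeftComod.isQuasifiniteInjective_star M.property
    let α := RightComod.starStarNatIso hR hL
    let β := LeftComod.starStarNatIso hR hL
    exact ⟨hR, hL, isEquivalence_of_rightOp_comp_iso _ _ α β,
      isEquivalence_of_rightOp_comp_iso _ _ β α, ⟨α⟩, ⟨β⟩⟩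
  · have h := isDualPair_hit he
    have hq : RightComod.IsQuasifiniteInjective (RightComod.hit e) :=
      ⟨RightComod.isQuasifinite_of_triangle (M := RightComod.hit e) h.right_triangle,
        RightComod.injective_of_triangle (M := RightComod.hit e) h.right_colinear
          h.right_triangle⟩
    obtain ⟨u, -, hu⟩ :=
      RightComod.exists_linearEquiv_of_isDualPair (M := RightComod.hit e) hq.1 h
    exact ⟨hq, ⟨LeftComod.isoOfLinearEquiv u hu⟩⟩
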